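/- Let $\{\mathbf X_{n,k}=(X_{n,k}^{(1)},X_{n,k}^{(2)}):1\le k\le n,\ n\ge 1\}$ be a triangular array of bivariate random vectors such that, for each $n$, the $2n$ variables of row $n$ are jointly Gaussian with mean zero and unit variance, with $$\operatorname{corr}(X_{n,k}^{(1)},X_{n,k}^{(2)})=\rho_0(n),\qquad \operatorname{corr}(X_{n,k}^{(i)},X_{n,l}^{(j)})=\rho_{ij}(|k-l|,n)\quad(1\le k\ne l\le n,\ i,j\in\{1,2\}).$$ Assume that $\sigma:=\sup_{n\ge2,\,1\le k<n,\,i,j\in\{1,2\}}|\rho_{ij}(k,n)|<1$ and that, for some $\alpha\in\bigl(0,\tfrac{1-\sigma}{1+\sigma}\bigr)$, $$\lim_{n\to\infty}\ \max_{\lfloor n^\alpha\rfloor\le k<n,\ i,j\in\{1,2\}}|\rho_{ij}(k,n)|\,\ln n=0 .$$ Assume further that $\lim_{n\to\infty}(1-\rho_0(n))\ln n=\lambda^2$ for some $\lambda\in[0,\infty]$ and, in the case $\lambda=\infty$, also that $(1+\rho_0(n))\ln n\to\infty$ (for $\lambda<\infty$ this holds automatically). Let $u_n(s)=a_ns+b_n$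 with $a_n=(2\ln n)^{-1/2}$ and $b_n=\sqrt{2\ln n}-\frac{\ln(4\pi\ln n)}{2\sqrt{2\ln n}}$, and let $M_n^{(i)}=\max_{1\le k\le n}X_{n,k}^{(i)}$, $m_n^{(i)}=\min_{1\le k\le n}X_{n,k}^{(i)}$. For $0<\lambda<\infty$ let $$H_\lambda(x,y)=\exp\Bigl(-\Phi\bigl(\lambda+\tfrac{x-y}{2\lambda}\bigr)e^{-y}-\Phi\bigl(\lambda+\tfrac{y-x}{2\lambda}\bigr)e^{-x}\Bigr),$$ where $\Phi$ is the standard normal distribution function, and let $H_0(x,y)=\min(\Lambda(x),\Lambda(y))$ and $H_\infty(x,y)=\Lambda(x)\Lambda(y)$, where $\Lambda(x)=\exp(-e^{-x})$. Then $$\lim_{n\to\infty}\ \sup_{x_1,x_2,y_1,y_2\in\mathbb R}\Bigl|\,\mathbb P\bigl(-u_n(y_i)<m_n^{(i)}\le M_n^{(i)}\le u_n(x_i),\ i=1,2\bigr)-H_\lambda(x_1,x_2)\,H_\lambda(y_1,y_2)\Bigr|=0 .$$ That is, the normalized componentwise maxima and componentwise minima are asymptotically independent. -/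

import Mathlib

open Filter Topology MeasureTheory ProbabilityTheory
open scoped ENNReal NNReal

/-- The standard Gaussian distribution function `Φ`. -/
noncomputable def stdNormalCDF (x : ℝ) : ℝ := cdf (gaussianReal 0 1) x

/-- The Gumbel distribution function `Λ(x) = exp (-exp (-x))`. -/
noncomputable def gumbelCDF (x : ℝ) : ℝ := Real.exp (-Real.exp (-x))

/-- The bivariate Hüsler-Reiss distribution function `H_λ`, `λ ∈ [0, ∞]`, with
`H_0 (x, y) = min (Λ x) (Λ y)` and `H_∞ (x, y) = Λ x * Λ y`. -/
noncomputable def huslerReissCDF (lam : ℝ≥0∞) (x y : ℝ) : ℝ :=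
  if lam = 0 then min (gumbelCDF x) (gumbelCDF y)
  else if lam = ⊤ then gumbelCDF x * gumbelCDF y
  else Real.exp
    (-stdNormalCDF (lam.toReal + (x - y) / (2 * lam.toReal)) * Real.exp (-y)
      - stdNormalCDF (lam.toReal + (y - x) / (2 * lam.toReal)) * Real.exp (-x))

/-- `a_n = 1 / √(2 ln n)`. -/
noncomputable def scaleConst (n : ℕ) : ℝ := 1 / √(2 * Real.log n)

/-- `b_n = √(2 ln n) - ln (4 π ln n) / (2 √(2 ln n))`. -/
noncomputable def locConst (n : ℕ) : ℝ :=
  √(2 * Real.log n) - 1 / (2 * √(2 * Real.log n)) * Real.log (4 * Real.pi * Real.log n)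

/-- `u_n(s) = a_n s + b_n`. -/
noncomputable def normLevel (n : ℕ) (s : ℝ) : ℝ := scaleConst n * s + locConst n

/-- A triangular array of bivariate Gaussian vectors: row `n` consists of the vectors
`(X n k 0, X n k 1)`, `k : Fin n`; each row is jointly Gaussian, all entries are centred with
unit variance (so covariances are correlations), the two components of one vector have
correlation `ρ₀ n`, and `X n k i`, `X n l j` with `k ≠ l` have correlation `ρ i j |k - l| n`.
Nothing is assumed about the dependence between different rows. -/
structure IsStationaryGaussianArray {Ω : Type*} [MeasurableSpace Ω] (P : Measure Ω)
    (X : (n : ℕ) → Fin n → Fin 2 → Ω → ℝ) (ρ₀ : ℕ → ℝ)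
    (ρ : Fin 2 → Fin 2 → ℕ → ℕ → ℝ) : Prop where
  gaussian : ∀ n : ℕ, HasGaussianLaw (fun ω (p : Fin n × Fin 2) => X n p.1 p.2 ω) P
  mean_zero : ∀ (n : ℕ) (k : Fin n) (i : Fin 2), ∫ ω, X n k i ω ∂P = 0
  unit_variance : ∀ (n : ℕ) (k : Fin n) (i : Fin 2), variance (X n k i) P = 1
  corr_same : ∀ (n : ℕ) (k : Fin n), covariance (X n k 0) (X n k 1) P = ρ₀ n
  corr_lag : ∀ (n : ℕ) (k l : Fin n) (i j : Fin 2), k ≠ l →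
    covariance (X n k i) (X n l j) P = ρ i j (((k : ℕ) : ℤ) - ((l : ℕ) : ℤ)).natAbs n

/-- `max { |ρ_ij(k, n)| : ⌊n^α⌋ ≤ k < n, i, j ∈ {1, 2} }`. The index set is non-empty
for `n ≥ 2` and `0 < α < 1`. -/
noncomputable def maxLateCorr (ρ : Fin 2 → Fin 2 → ℕ → ℕ → ℝ) (α : ℝ) (n : ℕ) : ℝ≥0 :=
  (Finset.Ico ⌊(n : ℝ) ^ α⌋₊ n).sup fun k =>
    Finset.univ.sup fun p : Fin 2 × Fin 2 => ‖ρ p.1 p.2 k n‖₊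

/-- The weak dependence (Berman type) condition: `σ = sup |ρ_ij(k, n)| < 1`, and for some
`α ∈ (0, (1 - σ) / (1 + σ))` one has `max_{⌊n^α⌋ ≤ k < n, i, j} |ρ_ij(k, n)| ln n → 0`. -/
def WeakDependence (ρ : Fin 2 → Fin 2 → ℕ → ℕ → ℝ) : Prop :=
  ∃ σ α : ℝ,
    IsLUB {r : ℝ | ∃ (n k : ℕ) (i j : Fin 2), 2 ≤ n ∧ 1 ≤ k ∧ k < n ∧ r = |ρ i j k n|} σ ∧
    σ < 1 ∧ 0 < α ∧ α < (1 - σ) / (1 + σ) ∧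
    Tendsto (fun n : ℕ => (maxLateCorr ρ α n : ℝ) * Real.log n) atTop (𝓝 0)

/-- The Hüsler-Reiss condition `(1 - ρ₀(n)) ln n → λ²` in `[0, ∞]`. For a correlation `ρ₀(n)`
the left side is non-negative, so that `ENNReal.ofReal` does not truncate. -/
def HuslerReissCondition (ρ₀ : ℕ → ℝ) (lam : ℝ≥0∞) : Prop :=
  Tendsto (fun n : ℕ => ENNReal.ofReal ((1 - ρ₀ n) * Real.log n)) atTop (𝓝 (lam ^ 2))

/-- The sample maximum of the `i`-th components of row `n` (a true maximum when `n ≥ 1`). -/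
noncomputable def rowMax {Ω : Type*} (X : (n : ℕ) → Fin n → Fin 2 → Ω → ℝ)
    (n : ℕ) (i : Fin 2) (ω : Ω) : ℝ := ⨆ k : Fin n, X n k i ω

/-- The sample minimum of the `i`-th components of row `n` (a true minimum when `n ≥ 1`). -/
noncomputable def rowMin {Ω : Type*} (X : (n : ℕ) → Fin n → Fin 2 → Ω → ℝ)
    (n : ℕ) (i : Fin 2) (ω : Ω) : ℝ := ⨅ k : Fin n, X n k i ω

/-! Interpolating between the covariance of a row and that of `n` independent pairs with the same
correlation within each pair, Plackett's identity bounds the difference of the box probabilities by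
a Berman sum, which vanishes under the weak dependence condition. For independent pairs only `n`
times the exceedance probability of one pair matters: conditioning on one coordinate turns its
limit into the Hüsler–Reiss exponent, while exceedances of a high and a low level by the same pair
are negligible, which decouples the maxima from the minima. Uniformity is Pólya's argument:
pointwise convergence of monotone functions to a continuous distribution function is uniform. -/

section Interpolation

open scoped Matrix SchwartzMap
open FourierTransform

variable {ι : Type*}

lemma posSemidef_interpolation {S₁ S₀ : Matrix ι ι ℝ} (hS₁ : S₁.PosSemidef)
    (hS₀ : S₀.PosSemidef) {t : ℝ} (ht : t ∈ Set.Icc (0 : ℝ) 1) :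
    (t • S₁ + (1 - t) • S₀).PosSemidef :=
  (hS₁.smul ht.1).add (hS₀.smul (sub_nonneg.2 ht.2))

variable [Fintype ι]

lemma integral_prod_eq_integral_fourier_mul_charFun (μ : Measure (EuclideanSpace ℝ ι))
    [IsFiniteMeasure μ] (f : ι → 𝓢(ℝ, ℂ)) :
    ∫ x, ∏ k, f k (x k) ∂μ =
      ∫ ξ : ι → ℝ, (∏ k, 𝓕 (f k) (ξ k)) * charFun μ (WithLp.toLp 2 ((2 * Real.pi) • ξ)) := by
  have inversion (k : ι) (x : ℝ) :
      f k x = ∫ ξ : ℝ, 𝓕 (f k) ξ * Complex.exp ((2 * Real.pi * ξ * x : ℝ) * Complex.I) := by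
    conv_lhs =>
      rw [← FourierTransform.fourierInv_fourier_eq (F := 𝓢(ℝ, ℂ)) (f k),
        SchwartzMap.fourierInv_coe, Real.fourierInv_eq']
    refine integral_congr_ae (ae_of_all _ fun ξ => ?_)
    simp only [smul_eq_mul, RCLike.inner_apply, conj_trivial, mul_comm (𝓕 (f k) ξ)]
    congr 4
    ring
  have prod_inversion (x : EuclideanSpace ℝ ι) :
      ∏ k, f k (x k) = ∫ ξ : ι → ℝ, (∏ k, 𝓕 (f k) (ξ k)) *
        Complex.exp (inner ℝ x (WithLp.toLp 2 ((2 * Real.pi) • ξ)) * Complex.I) := by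
    simp_rw [inversion]
    rw [← integral_fintype_prod_volume_eq_prod (fun k (ξ : ℝ) =>
      𝓕 (f k) ξ * Complex.exp ((2 * Real.pi * ξ * x k : ℝ) * Complex.I))]
    refine integral_congr_ae (ae_of_all _ fun ξ => ?_)
    simp only [Finset.prod_mul_distrib, ← Complex.exp_sum, ← Finset.sum_mul, PiLp.inner_apply,
      RCLike.inner_apply, conj_trivial, Pi.smul_apply, smul_eq_mul, Complex.ofReal_sum]
  simp_rw [prod_inversion, charFun_apply]
  rw [integral_integral_swap]
  · simp_rw [integral_const_mul]
  · have integrable_fourier : Integrable (fun p : EuclideanSpace ℝ ι × (ι → ℝ) =>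
        ∏ k, 𝓕 (f k) (p.2 k)) (μ.prod volume) :=
      (Integrable.fintype_prod fun k => (𝓕 (f k)).integrable).comp_snd μ
    refine integrable_fourier.mul_bdd (c := 1) (Continuous.aestronglyMeasurable ?_)
      (ae_of_all _ fun p => (Complex.norm_exp_ofReal_mul_I _).le)
    fun_prop

/-- The characteristic function at `2 * π * ξ` of the centred Gaussian law with covariance matrix
`S`; the factor `2 * π` matches the normalization of `𝓕`. -/
noncomputable def gaussianWeight (S : Matrix ι ι ℝ) (ξ : ι → ℝ) : ℝ :=
  Real.exp (-(2 * Real.pi ^ 2 * (ξ ⬝ᵥ S *ᵥ ξ)))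

lemma abs_gaussianWeight_le_one {S : Matrix ι ι ℝ} (hS : S.PosSemidef) (ξ : ι → ℝ) :
    |gaussianWeight S ξ| ≤ 1 := by
  have := hS.dotProduct_mulVec_nonneg ξ
  rw [star_trivial] at this
  rw [gaussianWeight, Real.abs_exp, Real.exp_le_one_iff]
  exact neg_nonpos.2 (by positivity)

@[fun_prop]
lemma continuous_gaussianWeight :
    Continuous fun p : Matrix ι ι ℝ × (ι → ℝ) => gaussianWeight p.1 p.2 := by
  unfold gaussianWeight dotProduct Matrix.mulVec dotProduct
  fun_prop

lemma gaussianWeight_sub (S₁ S₀ : Matrix ι ι ℝ) (ξ : ι → ℝ) :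
    gaussianWeight S₁ ξ - gaussianWeight S₀ ξ = ∫ t in (0 : ℝ)..1,
      -(2 * Real.pi ^ 2 * (ξ ⬝ᵥ (S₁ - S₀) *ᵥ ξ)) * gaussianWeight (t • S₁ + (1 - t) • S₀) ξ := by
  have quad (t : ℝ) : ξ ⬝ᵥ (t • S₁ + (1 - t) • S₀) *ᵥ ξ =
      t * (ξ ⬝ᵥ (S₁ - S₀) *ᵥ ξ) + ξ ⬝ᵥ S₀ *ᵥ ξ := by
    simp only [Matrix.add_mulVec, Matrix.sub_mulVec, Matrix.smul_mulVec, dotProduct_add,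
      dotProduct_sub, dotProduct_smul, smul_eq_mul]
    ring
  have hasDeriv (t : ℝ) : HasDerivAt (fun t => gaussianWeight (t • S₁ + (1 - t) • S₀) ξ)
      (-(2 * Real.pi ^ 2 * (ξ ⬝ᵥ (S₁ - S₀) *ᵥ ξ)) * gaussianWeight (t • S₁ + (1 - t) • S₀) ξ)
      t := by
    simp only [gaussianWeight, quad]
    have := (((hasDerivAt_mul_const (x := t) (ξ ⬝ᵥ (S₁ - S₀) *ᵥ ξ)).add_const
      (ξ ⬝ᵥ S₀ *ᵥ ξ)).const_mul (2 * Real.pi ^ 2)).fun_neg.exp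
    exact this.congr_deriv (mul_comm _ _)
  rw [intervalIntegral.integral_eq_sub_of_hasDerivAt (fun t _ => hasDeriv t)]
  · simp
  · refine Continuous.intervalIntegrable ?_ _ _
    fun_prop

lemma integrable_prod_fourier_mul_gaussianWeight {S : Matrix ι ι ℝ} (hS : S.PosSemidef)
    (f : ι → 𝓢(ℝ, ℂ)) :
    Integrable fun ξ : ι → ℝ => (∏ k, 𝓕 (f k) (ξ k)) * (gaussianWeight S ξ : ℂ) := by
  refine (Integrable.fintype_prod fun k => (𝓕 (f k)).integrable).mul_bdd (c := 1)
    (Continuous.aestronglyMeasurable (by fun_prop)) (ae_of_all _ fun ξ => ?_)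
  rw [Complex.norm_real]
  exact abs_gaussianWeight_le_one hS ξ

lemma integrable_prod_fourier_mul_gaussianWeight_interpolation {S₁ S₀ : Matrix ι ι ℝ}
    (hS₁ : S₁.PosSemidef) (hS₀ : S₀.PosSemidef) (f : ι → 𝓢(ℝ, ℂ)) :
    Integrable (fun p : ℝ × (ι → ℝ) => (∏ k, 𝓕 (f k) (p.2 k)) *
        (gaussianWeight (p.1 • S₁ + (1 - p.1) • S₀) p.2 : ℂ))
      ((volume.restrict (Set.uIoc (0 : ℝ) 1)).prod volume) := by
  have : IsFiniteMeasure (volume.restrict (Set.uIoc (0 : ℝ) 1)) :=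
    ⟨by rw [Set.uIoc_of_le zero_le_one]; simp⟩
  have mem_uIoc : ∀ᵐ p ∂((volume.restrict (Set.uIoc (0 : ℝ) 1)).prod
      (volume : Measure (ι → ℝ))), p.1 ∈ Set.uIoc (0 : ℝ) 1 :=
    Measure.quasiMeasurePreserving_fst.ae (ae_restrict_mem measurableSet_uIoc)
  refine ((Integrable.fintype_prod fun k => (𝓕 (f k)).integrable).comp_snd _).mul_bdd (c := 1)
    (Continuous.aestronglyMeasurable (by fun_prop)) ?_
  filter_upwards [mem_uIoc] with p hp
  rw [Set.uIoc_of_le zero_le_one] at hp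
  rw [Complex.norm_real]
  exact abs_gaussianWeight_le_one
    (posSemidef_interpolation hS₁ hS₀ (Set.Ioc_subset_Icc_self hp)) _

variable [DecidableEq ι]

lemma charFun_multivariateGaussian_two_pi_smul {S : Matrix ι ι ℝ} (hS : S.PosSemidef)
    (ξ : ι → ℝ) : charFun (multivariateGaussian 0 S) (WithLp.toLp 2 ((2 * Real.pi) • ξ)) =
      gaussianWeight S ξ := by
  rw [charFun_multivariateGaussian hS, gaussianWeight]
  simp only [Matrix.mulVec_smul, dotProduct_smul, smul_dotProduct, inner_zero_right, smul_eq_mul]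
  push_cast
  congr 1
  ring

lemma integral_prod_multivariateGaussian {S : Matrix ι ι ℝ} (hS : S.PosSemidef)
    (f : ι → 𝓢(ℝ, ℂ)) : ∫ x, ∏ k, f k (x k) ∂(multivariateGaussian 0 S) =
      ∫ ξ : ι → ℝ, (∏ k, 𝓕 (f k) (ξ k)) * gaussianWeight S ξ := by
  simp_rw [integral_prod_eq_integral_fourier_mul_charFun,
    charFun_multivariateGaussian_two_pi_smul hS]

/-- The product function of `f` with the factors indexed by `s` differentiated. -/
noncomputable abbrev derivFactors (f : ι → 𝓢(ℝ, ℂ)) (s : Finset ι) : ι → 𝓢(ℝ, ℂ) :=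
  s.piecewise (fun k => SchwartzMap.derivCLM ℝ ℂ (f k)) f

lemma fourier_derivCLM (f : 𝓢(ℝ, ℂ)) (ξ : ℝ) :
    𝓕 (SchwartzMap.derivCLM ℝ ℂ f) ξ = 2 * Real.pi * Complex.I * ξ * 𝓕 f ξ := by
  have coe_deriv : ⇑(SchwartzMap.derivCLM ℝ ℂ f) = deriv f :=
    funext (SchwartzMap.derivCLM_apply ℝ f)
  have := congrFun (Real.fourier_deriv f.integrable f.differentiable
    (coe_deriv ▸ (SchwartzMap.derivCLM ℝ ℂ f).integrable)) ξ
  simpa only [SchwartzMap.fourier_coe, coe_deriv, smul_eq_mul] using this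

lemma prod_fourier_derivFactors (f : ι → 𝓢(ℝ, ℂ)) (s : Finset ι) (ξ : ι → ℝ) :
    ∏ k, 𝓕 (derivFactors f s k) (ξ k) =
      (∏ k ∈ s, (2 * Real.pi * Complex.I * ξ k)) * ∏ k, 𝓕 (f k) (ξ k) := by
  have factor (k : ι) : 𝓕 (derivFactors f s k) (ξ k) =
      (if k ∈ s then 2 * Real.pi * Complex.I * ξ k else 1) * 𝓕 (f k) (ξ k) := by
    rw [derivFactors, Finset.piecewise]
    split_ifs
    · exact fourier_derivCLM _ _
    · rw [one_mul]
  simp_rw [factor]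
  rw [Finset.prod_mul_distrib, Finset.prod_ite_mem, Finset.univ_inter]

lemma prod_fourier_mul_dotProduct_mulVec (f : ι → 𝓢(ℝ, ℂ)) {D : Matrix ι ι ℝ}
    (hD : ∀ i, D i i = 0) (ξ : ι → ℝ) :
    (∏ k, 𝓕 (f k) (ξ k)) * (-(2 * Real.pi ^ 2 * (ξ ⬝ᵥ D *ᵥ ξ)) : ℝ) =
      ∑ i, ∑ j, (D i j / 2 : ℝ) * ∏ k, 𝓕 (derivFactors f {i, j} k) (ξ k) := by
  simp_rw [dotProduct, Matrix.mulVec, dotProduct, Finset.mul_sum, ← Finset.sum_neg_distrib,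
    Complex.ofReal_sum, Finset.mul_sum]
  refine Finset.sum_congr rfl fun i _ => Finset.sum_congr rfl fun j _ => ?_
  rcases eq_or_ne i j with rfl | hij
  · simp [hD]
  · rw [prod_fourier_derivFactors, Finset.prod_pair hij]
    push_cast
    linear_combination (-2) * (Real.pi : ℂ) ^ 2 * ξ i * ξ j * D i j * (∏ k, 𝓕 (f k) (ξ k)) *
      Complex.I_sq

/-- Plackett's identity: differentiating the Gaussian density in a covariance `S i j` amounts to
differentiating it in the coordinates `i` and `j`. -/
theorem integral_prod_sub_integral_prod {S₁ S₀ : Matrix ι ι ℝ} (hS₁ : S₁.PosSemidef)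
    (hS₀ : S₀.PosSemidef) (hdiag : ∀ i, S₁ i i = S₀ i i) (f : ι → 𝓢(ℝ, ℂ)) :
    ∫ x, ∏ k, f k (x k) ∂(multivariateGaussian 0 S₁) -
      ∫ x, ∏ k, f k (x k) ∂(multivariateGaussian 0 S₀) =
    ∫ t in (0 : ℝ)..1, ∑ i, ∑ j, ((S₁ i j - S₀ i j) / 2 : ℝ) *
      ∫ x, ∏ k, derivFactors f {i, j} k (x k)
        ∂(multivariateGaussian 0 (t • S₁ + (1 - t) • S₀)) := by
  set S : ℝ → Matrix ι ι ℝ := fun t => t • S₁ + (1 - t) • S₀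
  have hS {t : ℝ} (ht : t ∈ Set.Icc (0 : ℝ) 1) : (S t).PosSemidef :=
    posSemidef_interpolation hS₁ hS₀ ht
  have heat (t : ℝ) (ξ : ι → ℝ) : (∏ k, 𝓕 (f k) (ξ k)) *
      ((-(2 * Real.pi ^ 2 * (ξ ⬝ᵥ (S₁ - S₀) *ᵥ ξ)) * gaussianWeight (S t) ξ : ℝ) : ℂ) =
      ∑ i, ∑ j, ((S₁ i j - S₀ i j) / 2 : ℝ) *
        ((∏ k, 𝓕 (derivFactors f {i, j} k) (ξ k)) * (gaussianWeight (S t) ξ : ℂ)) := by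
    rw [Complex.ofReal_mul, ← mul_assoc,
      prod_fourier_mul_dotProduct_mulVec f fun i => sub_eq_zero.2 (hdiag i)]
    simp_rw [Finset.sum_mul, mul_assoc, Matrix.sub_apply]
  rw [integral_prod_multivariateGaussian hS₁, integral_prod_multivariateGaussian hS₀,
    ← integral_sub (integrable_prod_fourier_mul_gaussianWeight hS₁ f)
      (integrable_prod_fourier_mul_gaussianWeight hS₀ f)]
  simp_rw [← mul_sub, ← Complex.ofReal_sub, gaussianWeight_sub S₁ S₀,
    ← intervalIntegral.integral_ofReal, ← intervalIntegral.integral_const_mul]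
  simp_rw [show ∀ t, t • S₁ + (1 - t) • S₀ = S t from fun _ => rfl, heat]
  rw [← intervalIntegral_integral_swap]
  · refine intervalIntegral.integral_congr fun t ht => ?_
    rw [Set.uIcc_of_le zero_le_one] at ht
    have integrable (i j : ι) := (integrable_prod_fourier_mul_gaussianWeight (hS ht)
      (derivFactors f {i, j})).const_mul ((S₁ i j - S₀ i j) / 2 : ℝ)
    simp only [integral_prod_multivariateGaussian (hS ht)]
    rw [integral_finsetSum _ fun i _ => integrable_finsetSum _ fun j _ => integrable i j]
    refine Finset.sum_congr rfl fun i _ => ?_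
    rw [integral_finsetSum _ fun j _ => integrable i j]
    exact Finset.sum_congr rfl fun j _ => integral_const_mul _ _
  · exact integrable_finsetSum _ fun i _ => integrable_finsetSum _ fun j _ =>
      (integrable_prod_fourier_mul_gaussianWeight_interpolation hS₁ hS₀ _).const_mul _

lemma enorm_prod_derivFactors_pair_le {f : ι → 𝓢(ℝ, ℂ)} (hf : ∀ k x, ‖f k x‖ ≤ 1) {i j : ι}
    (hij : i ≠ j) (x : ι → ℝ) :
    ‖∏ k, derivFactors f {i, j} k (x k)‖ₑ ≤ ‖deriv (f i) (x i)‖ₑ * ‖deriv (f j) (x j)‖ₑ := by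
  have factor_le (k : ι) : ‖derivFactors f {i, j} k (x k)‖ₑ ≤
      if k ∈ ({i, j} : Finset ι) then ‖deriv (f k) (x k)‖ₑ else 1 := by
    rw [derivFactors, Finset.piecewise]
    split_ifs
    · rfl
    · exact enorm_le_coe.2 (hf k (x k))
  calc ‖∏ k, derivFactors f {i, j} k (x k)‖ₑ
      = ∏ k, ‖derivFactors f {i, j} k (x k)‖ₑ := by simp [enorm, nnnorm_prod]
    _ ≤ ∏ k, if k ∈ ({i, j} : Finset ι) then ‖deriv (f k) (x k)‖ₑ else 1 :=
        Finset.prod_le_prod' fun k _ => factor_le k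
    _ = ‖deriv (f i) (x i)‖ₑ * ‖deriv (f j) (x j)‖ₑ := by
        rw [Finset.prod_ite_mem, Finset.univ_inter, Finset.prod_pair hij]

theorem norm_integral_prod_sub_integral_prod_le {S₁ S₀ : Matrix ι ι ℝ} (hS₁ : S₁.PosSemidef)
    (hS₀ : S₀.PosSemidef) (hdiag : ∀ i, S₁ i i = S₀ i i) {f : ι → 𝓢(ℝ, ℂ)}
    (hf : ∀ k x, ‖f k x‖ ≤ 1) {B : ι → ι → ℝ≥0}
    (hB : ∀ i j, i ≠ j → S₁ i j ≠ S₀ i j → ∀ t ∈ Set.Icc (0 : ℝ) 1,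
      ∫⁻ x, ‖deriv (f i) (x i)‖ₑ * ‖deriv (f j) (x j)‖ₑ
        ∂(multivariateGaussian 0 (t • S₁ + (1 - t) • S₀)) ≤ B i j) :
    ‖∫ x, ∏ k, f k (x k) ∂(multivariateGaussian 0 S₁) -
      ∫ x, ∏ k, f k (x k) ∂(multivariateGaussian 0 S₀)‖ ≤
      ∑ i, ∑ j, |S₁ i j - S₀ i j| / 2 * B i j := by
  rw [integral_prod_sub_integral_prod hS₁ hS₀ hdiag]
  refine (intervalIntegral.norm_integral_le_of_norm_le_const
    (C := ∑ i, ∑ j, |S₁ i j - S₀ i j| / 2 * B i j) fun t ht => ?_).trans (by simp)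
  rw [Set.uIoc_of_le zero_le_one] at ht
  refine norm_sum_le_of_le _ fun i _ => norm_sum_le_of_le _ fun j _ => ?_
  rw [norm_mul, Complex.norm_real, Real.norm_eq_abs, abs_div, abs_two]
  by_cases hne : S₁ i j = S₀ i j
  · simp [hne]
  have hij : i ≠ j := by
    rintro rfl
    exact hne (hdiag i)
  refine mul_le_mul_of_nonneg_left ?_ (by positivity)
  refine enorm_le_coe.1 ((enorm_integral_le_lintegral_enorm _).trans (le_trans ?_
    (hB i j hij hne t (Set.Ioc_subset_Icc_self ht))))
  exact lintegral_mono fun x => enorm_prod_derivFactors_pair_le hf hij x.ofLp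

end Interpolation

section SmoothCutoff

open scoped SchwartzMap

/-- A smooth monotone approximation, on the scale `ε`, of the indicator of `(a, ∞)`. -/
noncomputable def smoothStep (a ε x : ℝ) : ℝ := Real.smoothTransition ((x - a) / ε)

section SmoothStep

variable {a b ε x : ℝ}

lemma contDiff_smoothStep {n : ℕ∞} : ContDiff ℝ n (smoothStep a ε) :=
  Real.smoothTransition.contDiff.comp (by fun_prop)

lemma hasDerivAt_smoothStep (a ε x : ℝ) :
    HasDerivAt (smoothStep a ε) (deriv (smoothStep a ε) x) x :=
  ((contDiff_smoothStep (n := 1)).differentiable one_ne_zero x).hasDerivAt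

lemma smoothStep_monotone (hε : 0 < ε) : Monotone (smoothStep a ε) := fun x y hxy =>
  Real.smoothTransition.monotone (by gcongr)

lemma smoothStep_anti_left (hε : 0 < ε) (hab : a ≤ b) : smoothStep b ε x ≤ smoothStep a ε x :=
  Real.smoothTransition.monotone (by gcongr)

lemma smoothStep_of_le (hε : 0 < ε) (hx : x ≤ a) : smoothStep a ε x = 0 :=
  Real.smoothTransition.zero_of_nonpos (div_nonpos_of_nonpos_of_nonneg (sub_nonpos.2 hx) hε.le)

lemma smoothStep_of_add_le (hε : 0 < ε) (hx : a + ε ≤ x) : smoothStep a ε x = 1 :=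
  Real.smoothTransition.one_of_one_le ((one_le_div hε).2 (le_sub_iff_add_le'.2 hx))

lemma tendsto_smoothStep (a x : ℝ) :
    Tendsto (fun ε => smoothStep a ε x) (𝓝[>] 0) (𝓝 ((Set.Ioi a).indicator 1 x)) := by
  refine tendsto_const_nhds.congr' ?_
  rcases le_or_gt x a with hxa | hxa
  · filter_upwards [self_mem_nhdsWithin] with ε hε
    rw [smoothStep_of_le hε hxa, Set.indicator_of_notMem (Set.notMem_Ioi.2 hxa)]
  · filter_upwards [self_mem_nhdsWithin, Ioo_mem_nhdsGT (sub_pos.2 hxa)] with ε hε hεx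
    rw [smoothStep_of_add_le hε (by linarith [hεx.2]),
      Set.indicator_of_mem (Set.mem_Ioi.2 hxa), Pi.one_apply]

lemma support_deriv_smoothStep_subset (hε : 0 < ε) :
    Function.support (deriv (smoothStep a ε)) ⊆ Set.Icc a (a + ε) := by
  refine Function.support_subset_iff'.2 fun x hx => ?_
  rw [Set.mem_Icc, not_and_or, not_le, not_le] at hx
  rcases hx with hx | hx
  · have : smoothStep a ε =ᶠ[𝓝 x] fun _ => 0 := by
      filter_upwards [Iio_mem_nhds hx] with y hy using smoothStep_of_le hε (le_of_lt hy)
    rw [this.deriv_eq, deriv_const]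
  · have : smoothStep a ε =ᶠ[𝓝 x] fun _ => 1 := by
      filter_upwards [Ioi_mem_nhds hx] with y hy using smoothStep_of_add_le hε (le_of_lt hy)
    rw [this.deriv_eq, deriv_const]

lemma lintegral_enorm_deriv_smoothStep (hε : 0 < ε) :
    ∫⁻ x, ‖deriv (smoothStep a ε) x‖ₑ = 1 := by
  have integrable : Integrable (deriv (smoothStep a ε)) :=
    ((contDiff_smoothStep (n := 1)).continuous_deriv le_rfl).integrable_of_hasCompactSupport
      (HasCompactSupport.of_support_subset_isCompact isCompact_Icc
        (support_deriv_smoothStep_subset hε))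
  have total : ∫ x, deriv (smoothStep a ε) x = 1 - 0 :=
    integral_of_hasDerivAt_of_tendsto (hasDerivAt_smoothStep a ε) integrable
      (tendsto_const_nhds.congr' (by
        filter_upwards [eventually_le_atBot a] with x hx using (smoothStep_of_le hε hx).symm))
      (tendsto_const_nhds.congr' (by
        filter_upwards [eventually_ge_atTop (a + ε)] with x hx
        exact (smoothStep_of_add_le hε hx).symm))
  rw [← ofReal_integral_norm_eq_lintegral_enorm integrable]
  simp_rw [Real.norm_of_nonneg (smoothStep_monotone hε).deriv_nonneg]
  rw [total, sub_zero, ENNReal.ofReal_one]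

lemma hasCompactSupport_smoothStep_sub (hε : 0 < ε) (hab : a ≤ b) :
    HasCompactSupport fun x => smoothStep a ε x - smoothStep b ε x := by
  refine HasCompactSupport.intro (isCompact_Icc (a := a) (b := b + ε)) fun x hx => ?_
  rw [Set.mem_Icc, not_and_or, not_le, not_le] at hx
  rcases hx with hx | hx
  · rw [smoothStep_of_le hε hx.le, smoothStep_of_le hε (hx.le.trans hab), sub_zero]
  · rw [smoothStep_of_add_le hε hx.le, smoothStep_of_add_le hε (by linarith), sub_self]

end SmoothStep

/-- A smooth compactly supported approximation, on the scale `ε`, of the indicator of `(a, b]`,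
as a complex-valued Schwartz function. -/
noncomputable def smoothCutoff {a b ε : ℝ} (hε : 0 < ε) (hab : a ≤ b) : 𝓢(ℝ, ℂ) :=
  ((hasCompactSupport_smoothStep_sub hε hab).comp_left Complex.ofReal_zero).toSchwartzMap
    (Complex.ofRealCLM.contDiff.comp (contDiff_smoothStep.sub contDiff_smoothStep))

section

variable {a b ε : ℝ} (hε : 0 < ε) (hab : a ≤ b)

lemma smoothCutoff_apply (x : ℝ) :
    smoothCutoff hε hab x = (smoothStep a ε x - smoothStep b ε x : ℝ) := rfl

lemma norm_smoothCutoff_le_one (x : ℝ) : ‖smoothCutoff hε hab x‖ ≤ 1 := by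
  rw [smoothCutoff_apply, Complex.norm_real,
    Real.norm_of_nonneg (sub_nonneg.2 (smoothStep_anti_left hε hab))]
  exact (sub_le_self _ (Real.smoothTransition.nonneg _)).trans (Real.smoothTransition.le_one _)

lemma deriv_smoothCutoff (x : ℝ) : deriv (smoothCutoff hε hab) x =
    (deriv (smoothStep a ε) x - deriv (smoothStep b ε) x : ℝ) :=
  ((hasDerivAt_smoothStep a ε x).sub (hasDerivAt_smoothStep b ε x)).ofReal_comp.deriv

lemma lintegral_enorm_deriv_smoothCutoff_le :
    ∫⁻ x, ‖deriv (smoothCutoff hε hab) x‖ₑ ≤ 2 := by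
  calc ∫⁻ x, ‖deriv (smoothCutoff hε hab) x‖ₑ
      ≤ ∫⁻ x, (‖deriv (smoothStep a ε) x‖ₑ + ‖deriv (smoothStep b ε) x‖ₑ) := by
        refine lintegral_mono fun x => ?_
        rw [deriv_smoothCutoff, Complex.ofReal_sub]
        refine enorm_sub_le.trans_eq ?_
        simp only [← ofReal_norm, Complex.norm_real]
    _ = 2 := by
        rw [lintegral_add_left (measurable_deriv _).enorm, lintegral_enorm_deriv_smoothStep hε,
          lintegral_enorm_deriv_smoothStep hε, one_add_one_eq_two]

lemma deriv_smoothCutoff_eq_zero {w x : ℝ} (ha : w ≤ |a|) (hb : w ≤ |b|) (hx : |x| < w - ε) :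
    deriv (smoothCutoff hε hab) x = 0 := by
  have step {c : ℝ} (hc : w ≤ |c|) : deriv (smoothStep c ε) x = 0 := by
    refine Function.notMem_support.1 fun hmem => ?_
    obtain ⟨hcx, hxc⟩ := support_deriv_smoothStep_subset hε hmem
    obtain ⟨hx₁, hx₂⟩ := abs_lt.1 hx
    rcases le_abs.1 hc with h | h <;> linarith
  rw [deriv_smoothCutoff, step ha, step hb, sub_zero, Complex.ofReal_zero]

end

end SmoothCutoff

section BivariateGaussian

variable {Ω Ω' ι : Type*} {mΩ : MeasurableSpace Ω} {mΩ' : MeasurableSpace Ω'} {P : Measure Ω}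
  {P' : Measure Ω'}

lemma charFunDual_map_of_hasGaussianLaw [Fintype ι] [DecidableEq ι] {X : ι → Ω → ℝ}
    (hX : HasGaussianLaw (fun ω i => X i ω) P) (L : StrongDual ℝ (ι → ℝ)) :
    charFunDual (P.map fun ω i => X i ω) L =
      Complex.exp ((∑ i, L (Pi.single i 1) * ∫ ω, X i ω ∂P : ℝ) * Complex.I -
        (∑ i, ∑ j, L (Pi.single i 1) * (L (Pi.single j 1) * cov[X i, X j; P]) : ℝ) / 2) := by
  have := hX.isProbabilityMeasure
  have memLp (i : ι) : MemLp (X i) 2 P := (hX.eval i).memLp_two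
  have expand : (fun ω => L fun i => X i ω) = fun ω => ∑ i, L (Pi.single i 1) * X i ω := by
    funext ω
    conv_lhs => rw [pi_eq_sum_univ' fun i => X i ω]
    simp only [map_sum, map_smul, smul_eq_mul, mul_comm]
  have mean : ∫ ω, L (fun i => X i ω) ∂P = ∑ i, L (Pi.single i 1) * ∫ ω, X i ω ∂P := by
    rw [expand, integral_finsetSum _ fun i _ => ((hX.eval i).integrable.const_mul _)]
    simp_rw [integral_const_mul]
  have var : Var[fun ω => L fun i => X i ω; P] =
      ∑ i, ∑ j, L (Pi.single i 1) * (L (Pi.single j 1) * cov[X i, X j; P]) := by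
    rw [expand, variance_fun_sum fun i => (memLp i).const_mul _]
    simp_rw [covariance_const_mul_left, covariance_const_mul_right]
  rw [hX.charFunDual_map_eq_fun, mean, var]

lemma map_eq_map_of_covariance_eq [Finite ι] {X : ι → Ω → ℝ} {Y : ι → Ω' → ℝ}
    (hX : HasGaussianLaw (fun ω i => X i ω) P) (hY : HasGaussianLaw (fun ω i => Y i ω) P')
    (hmean : ∀ i, ∫ ω, X i ω ∂P = ∫ ω, Y i ω ∂P')
    (hcov : ∀ i j, cov[X i, X j; P] = cov[Y i, Y j; P']) :
    P.map (fun ω i => X i ω) = P'.map (fun ω i => Y i ω) := by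
  classical
  have := Fintype.ofFinite ι
  have := hX.isProbabilityMeasure
  have := hY.isProbabilityMeasure
  have := Measure.isProbabilityMeasure_map hX.aemeasurable
  have := Measure.isProbabilityMeasure_map hY.aemeasurable
  refine Measure.ext_of_charFunDual (funext fun L => ?_)
  simp_rw [charFunDual_map_of_hasGaussianLaw hX, charFunDual_map_of_hasGaussianLaw hY, hmean, hcov]

/-- The bivariate centred Gaussian law with unit variances and correlation `r`. -/
noncomputable def bivLaw (r : ℝ) : Measure (ℝ × ℝ) :=
  ((gaussianReal 0 1).prod (gaussianReal 0 1)).map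
    fun p => (p.1, r * p.1 + √(1 - r ^ 2) * p.2)

lemma measurable_bivLaw_map (r : ℝ) :
    Measurable fun p : ℝ × ℝ => (p.1, r * p.1 + √(1 - r ^ 2) * p.2) := by fun_prop

instance (r : ℝ) : IsProbabilityMeasure (bivLaw r) :=
  Measure.isProbabilityMeasure_map (measurable_bivLaw_map r).aemeasurable

instance (r : ℝ) : IsGaussian (bivLaw r) :=
  inferInstanceAs (IsGaussian (Measure.map ((ContinuousLinearMap.fst ℝ ℝ ℝ).prod
    (r • ContinuousLinearMap.fst ℝ ℝ ℝ + √(1 - r ^ 2) • ContinuousLinearMap.snd ℝ ℝ ℝ)) _))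

lemma integral_prod_gaussianReal_linear (a b : ℝ) :
    ∫ p, (a * p.1 + b * p.2) ∂((gaussianReal 0 1).prod (gaussianReal 0 1)) = 0 := by
  have integrable : Integrable (fun x : ℝ => x) (gaussianReal 0 1) := IsGaussian.integrable_id
  rw [integral_add ((integrable.comp_fst _).const_mul a) ((integrable.comp_snd _).const_mul b),
    integral_const_mul, integral_const_mul, integral_fun_fst (fun x : ℝ => x),
    integral_fun_snd (fun x : ℝ => x), integral_id_gaussianReal]
  simp only [smul_zero, mul_zero, add_zero]

lemma covariance_prod_gaussianReal_linear (a b c d : ℝ) :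
    cov[fun p => a * p.1 + b * p.2, fun p => c * p.1 + d * p.2;
      (gaussianReal 0 1).prod (gaussianReal 0 1)] = a * c + b * d := by
  have memLp : MemLp (fun x : ℝ => x) 2 (gaussianReal 0 1) := memLp_id_gaussianReal 2
  have memLp_fst := memLp.comp_fst (gaussianReal 0 1)
  have memLp_snd := memLp.comp_snd (gaussianReal 0 1)
  have var_fst : Var[fun p : ℝ × ℝ => p.1; (gaussianReal 0 1).prod (gaussianReal 0 1)] = 1 :=
    (variance_map (X := id) aemeasurable_id measurable_fst.aemeasurable).symm.trans (by
      rw [Measure.map_fst_prod, measure_univ, one_smul, variance_id_gaussianReal, NNReal.coe_one])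
  have var_snd : Var[fun p : ℝ × ℝ => p.2; (gaussianReal 0 1).prod (gaussianReal 0 1)] = 1 :=
    (variance_map (X := id) aemeasurable_id measurable_snd.aemeasurable).symm.trans (by
      rw [Measure.map_snd_prod, measure_univ, one_smul, variance_id_gaussianReal, NNReal.coe_one])
  have cov_fst_snd := covariance_fst_snd_prod memLp memLp
  have cov_snd_fst := cov_fst_snd
  rw [covariance_comm] at cov_snd_fst
  simp only [← Pi.add_def]
  rw [covariance_add_left (memLp_fst.const_mul a) (memLp_snd.const_mul b)
      ((memLp_fst.const_mul c).add (memLp_snd.const_mul d)),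
    covariance_add_right (memLp_fst.const_mul a) (memLp_fst.const_mul c) (memLp_snd.const_mul d),
    covariance_add_right (memLp_snd.const_mul b) (memLp_fst.const_mul c) (memLp_snd.const_mul d)]
  simp only [covariance_const_mul_left, covariance_const_mul_right, cov_fst_snd, cov_snd_fst]
  rw [covariance_self (by fun_prop), covariance_self (by fun_prop), var_fst, var_snd]
  ring

lemma integral_linear_bivLaw (r a b : ℝ) : ∫ p, (a * p.1 + b * p.2) ∂(bivLaw r) = 0 := by
  rw [bivLaw, integral_map (measurable_bivLaw_map r).aemeasurable (by fun_prop)]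
  refine Eq.trans (integral_congr_ae (ae_of_all _ fun p => ?_))
    (integral_prod_gaussianReal_linear (a + b * r) (b * √(1 - r ^ 2)))
  ring

lemma covariance_linear_bivLaw {r : ℝ} (hr : |r| ≤ 1) (a b c d : ℝ) :
    cov[fun p => a * p.1 + b * p.2, fun p => c * p.1 + d * p.2; bivLaw r] =
      a * c + b * d + r * (a * d + b * c) := by
  have sq_sqrt : √(1 - r ^ 2) ^ 2 = 1 - r ^ 2 :=
    Real.sq_sqrt (sub_nonneg.2 ((sq_le_one_iff_abs_le_one r).2 hr))
  calc cov[fun p => a * p.1 + b * p.2, fun p => c * p.1 + d * p.2; bivLaw r]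
      = cov[fun p => (a + b * r) * p.1 + b * √(1 - r ^ 2) * p.2,
          fun p => (c + d * r) * p.1 + d * √(1 - r ^ 2) * p.2;
          (gaussianReal 0 1).prod (gaussianReal 0 1)] := by
        rw [bivLaw, covariance_map (by fun_prop) (by fun_prop)
          (measurable_bivLaw_map r).aemeasurable]
        congr 1 <;> funext p <;> simp only [Function.comp_apply] <;> ring
    _ = _ := by
        rw [covariance_prod_gaussianReal_linear]
        linear_combination b * d * sq_sqrt

lemma variance_linear_bivLaw {r : ℝ} (hr : |r| ≤ 1) (a b : ℝ) :
    Var[fun p => a * p.1 + b * p.2; bivLaw r] = a * a + b * b + r * (a * b + b * a) := by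
  rw [← covariance_self (by fun_prop), covariance_linear_bivLaw hr]

lemma map_prodMk_eq_bivLaw {X Y : Ω → ℝ} {r : ℝ} (hr : |r| ≤ 1)
    (hXY : HasGaussianLaw (fun ω => (X ω, Y ω)) P)
    (hX : ∫ ω, X ω ∂P = 0) (hY : ∫ ω, Y ω ∂P = 0) (hX' : Var[X; P] = 1) (hY' : Var[Y; P] = 1)
    (hcov : cov[X, Y; P] = r) : P.map (fun ω => (X ω, Y ω)) = bivLaw r := by
  have := hXY.isProbabilityMeasure
  have := Measure.isProbabilityMeasure_map hXY.aemeasurable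
  refine Measure.ext_of_charFunDual (funext fun L => ?_)
  obtain ⟨a, b, hL⟩ : ∃ a b : ℝ, ∀ p, L p = a * p.1 + b * p.2 := by
    refine ⟨L (1, 0), L (0, 1), fun p => ?_⟩
    conv_lhs => rw [show p = p.1 • ((1, 0) : ℝ × ℝ) + p.2 • ((0, 1) : ℝ × ℝ) by ext <;> simp]
    rw [map_add, map_smul, map_smul, smul_eq_mul, smul_eq_mul, mul_comm, mul_comm p.2]
  have mean : ∫ ω, (a * X ω + b * Y ω) ∂P = 0 := by
    rw [integral_add (hXY.fst.integrable.const_mul a) (hXY.snd.integrable.const_mul b),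
      integral_const_mul, integral_const_mul, hX, hY, mul_zero, mul_zero, add_zero]
  have var : Var[fun ω => a * X ω + b * Y ω; P] = Var[fun p => a * p.1 + b * p.2; bivLaw r] := by
    rw [variance_fun_add (hXY.fst.memLp_two.const_mul a) (hXY.snd.memLp_two.const_mul b),
      variance_const_mul, variance_const_mul, covariance_const_mul_left, covariance_const_mul_right,
      hX', hY', hcov, variance_linear_bivLaw hr]
    ring
  rw [hXY.charFunDual_map_eq_fun, IsGaussian.charFunDual_eq]
  simp only [funext hL, integral_complex_ofReal, integral_linear_bivLaw, mean, var]

lemma bivLaw_map_swap {r : ℝ} (hr : |r| ≤ 1) : (bivLaw r).map Prod.swap = bivLaw r := by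
  have cov := covariance_linear_bivLaw hr
  have var := variance_linear_bivLaw hr
  have moment := integral_linear_bivLaw r
  have gaussian := (IsGaussian.hasGaussianLaw_id (μ := bivLaw r)).map_equiv_fun
    (ContinuousLinearEquiv.prodComm ℝ ℝ ℝ)
  refine map_prodMk_eq_bivLaw hr gaussian ?_ ?_ ?_ ?_ ?_
  · simpa using moment 0 1
  · simpa using moment 1 0
  · simpa using var 0 1
  · simpa using var 1 0
  · simpa using cov 0 1 1 0

lemma bivLaw_map_neg {r : ℝ} (hr : |r| ≤ 1) : (bivLaw r).map (fun p => -p) = bivLaw r := by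
  have cov := covariance_linear_bivLaw hr
  have var := variance_linear_bivLaw hr
  have moment := integral_linear_bivLaw r
  have gaussian := (IsGaussian.hasGaussianLaw_id (μ := bivLaw r)).map_equiv_fun
    (ContinuousLinearEquiv.neg ℝ)
  refine map_prodMk_eq_bivLaw hr gaussian ?_ ?_ ?_ ?_ ?_
  · simpa using moment (-1) 0
  · simpa using moment 0 (-1)
  · simpa using var (-1) 0
  · simpa using var 0 (-1)
  · simpa using cov (-1) 0 0 (-1)

end BivariateGaussian

section DensityBound

variable {r w x y : ℝ} {f g : ℝ → ℝ≥0∞}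

lemma gaussianReal_map_const_add_const_mul (m : ℝ) {c : ℝ} {v : ℝ≥0} (hc : c ^ 2 = v) :
    (gaussianReal 0 1).map (fun y => m + c * y) = gaussianReal m v := by
  rw [← Function.comp_def (fun y => m + y), ← Measure.map_map (by fun_prop) (by fun_prop),
    gaussianReal_map_const_mul, gaussianReal_map_const_add, mul_zero, zero_add, mul_one]
  congr 1
  exact NNReal.eq hc

lemma lintegral_bivLaw (hr : |r| < 1) {F : ℝ × ℝ → ℝ≥0∞} (hF : Measurable F) :
    ∫⁻ p, F p ∂(bivLaw r) = ∫⁻ x, ∫⁻ y,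
      gaussianPDF 0 1 x * gaussianPDF (r * x) (1 - r ^ 2).toNNReal y * F (x, y) := by
  have hpos : 0 < 1 - r ^ 2 := sub_pos.2 ((sq_lt_one_iff_abs_lt_one r).2 hr)
  have inner (x : ℝ) : ∫⁻ y, F (x, r * x + √(1 - r ^ 2) * y) ∂(gaussianReal 0 1) =
      ∫⁻ y, gaussianPDF (r * x) (1 - r ^ 2).toNNReal y * F (x, y) := by
    rw [← lintegral_map (f := fun y => F (x, y)) (by fun_prop) (by fun_prop),
      gaussianReal_map_const_add_const_mul (v := (1 - r ^ 2).toNNReal) (r * x)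
        (by rw [Real.sq_sqrt hpos.le, Real.coe_toNNReal _ hpos.le]),
      gaussianReal_of_var_ne_zero _ (Real.toNNReal_pos.2 hpos).ne',
      lintegral_withDensity_eq_lintegral_mul _ (measurable_gaussianPDF _ _) (by fun_prop)]
    rfl
  have measurable_inner : Measurable fun x =>
      ∫⁻ y, F (x, r * x + √(1 - r ^ 2) * y) ∂(gaussianReal 0 1) :=
    Measurable.lintegral_prod_right' (f := fun p : ℝ × ℝ => F (p.1, r * p.1 + √(1 - r ^ 2) * p.2))
      (by fun_prop)
  rw [bivLaw, lintegral_map hF (measurable_bivLaw_map r), lintegral_prod _ (by fun_prop),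
    gaussianReal_of_var_ne_zero _ one_ne_zero,
    lintegral_withDensity_eq_lintegral_mul _ (measurable_gaussianPDF _ _)
      (by rwa [← gaussianReal_of_var_ne_zero _ one_ne_zero])]
  refine lintegral_congr fun x => ?_
  rw [Pi.mul_apply, ← gaussianReal_of_var_ne_zero _ one_ne_zero, inner,
    ← lintegral_const_mul _ (by fun_prop)]
  simp only [mul_assoc]

lemma two_mul_sq_mul_one_sub_abs_le (hr : |r| ≤ 1) (hw : 0 ≤ w) (hx : w ≤ |x|) (hy : w ≤ |y|) :
    2 * w ^ 2 * (1 - |r|) ≤ x ^ 2 - 2 * (r * x * y) + y ^ 2 := by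
  have hx' : w ^ 2 ≤ x ^ 2 := by rw [← sq_abs x]; gcongr
  have hy' : w ^ 2 ≤ y ^ 2 := by rw [← sq_abs y]; gcongr
  have cross : 2 * (r * x * y) ≤ |r| * (x ^ 2 + y ^ 2) := by
    calc 2 * (r * x * y) ≤ |r| * (2 * |x| * |y|) :=
          (le_abs_self _).trans_eq (by rw [abs_mul, abs_mul, abs_mul, abs_two]; ring)
      _ ≤ |r| * (x ^ 2 + y ^ 2) := by
          gcongr
          simpa only [sq_abs] using two_mul_le_add_sq |x| |y|
  nlinarith

lemma gaussianPDFReal_mul_gaussianPDFReal_le (hr : |r| < 1) (hw : 0 ≤ w) (hx : w ≤ |x|)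
    (hy : w ≤ |y|) :
    gaussianPDFReal 0 1 x * gaussianPDFReal (r * x) (1 - r ^ 2).toNNReal y ≤
      (2 * Real.pi * √(1 - r ^ 2))⁻¹ * Real.exp (-w ^ 2 / (1 + |r|)) := by
  have hpos : 0 < 1 - r ^ 2 := sub_pos.2 ((sq_lt_one_iff_abs_lt_one r).2 hr)
  have hpos' : 0 < 1 - |r| := sub_pos.2 hr
  have factor : 1 - r ^ 2 = (1 - |r|) * (1 + |r|) := by rw [← sq_abs r]; ring
  have normalization : (√(2 * Real.pi * 1))⁻¹ * (√(2 * Real.pi * (1 - r ^ 2)))⁻¹ =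
      (2 * Real.pi * √(1 - r ^ 2))⁻¹ := by
    rw [mul_one, Real.sqrt_mul (x := 2 * Real.pi) (by positivity) (1 - r ^ 2), ← mul_inv,
      ← mul_assoc, Real.mul_self_sqrt (by positivity)]
  have exponent : -(x - 0) ^ 2 / (2 * 1) + -(y - r * x) ^ 2 / (2 * (1 - r ^ 2)) ≤
      -w ^ 2 / (1 + |r|) := by
    calc -(x - 0) ^ 2 / (2 * 1) + -(y - r * x) ^ 2 / (2 * (1 - r ^ 2))
        = -(x ^ 2 - 2 * (r * x * y) + y ^ 2) / (2 * (1 - r ^ 2)) := by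
          field_simp
          ring
      _ ≤ -(2 * w ^ 2 * (1 - |r|)) / (2 * (1 - r ^ 2)) := by
          gcongr
          exact two_mul_sq_mul_one_sub_abs_le hr.le hw hx hy
      _ = -w ^ 2 / (1 + |r|) := by
          rw [factor]
          field_simp
  rw [gaussianPDFReal, gaussianPDFReal, Real.coe_toNNReal _ hpos.le, NNReal.coe_one,
    mul_mul_mul_comm, normalization, ← Real.exp_add]
  gcongr

lemma lintegral_mul_bivLaw_le (hr : |r| < 1) (hw : 0 ≤ w) (hf : Measurable f) (hg : Measurable g)
    (hfw : ∀ x, |x| < w → f x = 0) (hgw : ∀ x, |x| < w → g x = 0) :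
    ∫⁻ p, f p.1 * g p.2 ∂(bivLaw r) ≤
      ENNReal.ofReal ((2 * Real.pi * √(1 - r ^ 2))⁻¹ * Real.exp (-w ^ 2 / (1 + |r|))) *
        ((∫⁻ x, f x) * ∫⁻ x, g x) := by
  set K := (2 * Real.pi * √(1 - r ^ 2))⁻¹ * Real.exp (-w ^ 2 / (1 + |r|))
  have density_le (x y : ℝ) :
      gaussianPDF 0 1 x * gaussianPDF (r * x) (1 - r ^ 2).toNNReal y * (f x * g y) ≤
        ENNReal.ofReal K * (f x * g y) := by
    rcases lt_or_ge |x| w with hx | hx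
    · rw [hfw x hx, zero_mul, mul_zero, mul_zero]
    rcases lt_or_ge |y| w with hy | hy
    · rw [hgw y hy, mul_zero, mul_zero, mul_zero]
    gcongr
    rw [gaussianPDF, gaussianPDF, ← ENNReal.ofReal_mul (gaussianPDFReal_nonneg _ _ _)]
    exact ENNReal.ofReal_le_ofReal (gaussianPDFReal_mul_gaussianPDFReal_le hr hw hx hy)
  calc ∫⁻ p, f p.1 * g p.2 ∂(bivLaw r)
      ≤ ∫⁻ x, ∫⁻ y, ENNReal.ofReal K * (f x * g y) := by
        rw [lintegral_bivLaw hr (by fun_prop)]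
        exact lintegral_mono fun x => lintegral_mono fun y => density_le x y
    _ = ENNReal.ofReal K * ((∫⁻ x, f x) * ∫⁻ x, g x) := by
        simp_rw [lintegral_const_mul _ (hg.const_mul _), lintegral_const_mul _ hg]
        rw [lintegral_const_mul _ (hf.mul_const _), lintegral_mul_const _ hf]

lemma density_bound_mono {R σ : ℝ} (hrR : |r| ≤ R) (hRσ : R ≤ σ) (hσ : σ < 1) :
    (2 * Real.pi * √(1 - r ^ 2))⁻¹ * Real.exp (-w ^ 2 / (1 + |r|)) ≤
      (2 * Real.pi * √(1 - σ ^ 2))⁻¹ * Real.exp (-w ^ 2 / (1 + R)) := by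
  have hR : 0 ≤ R := (abs_nonneg r).trans hrR
  have hσ' : 0 < √(1 - σ ^ 2) :=
    Real.sqrt_pos.2 (sub_pos.2 (pow_lt_one₀ (hR.trans hRσ) hσ two_ne_zero))
  have : r ^ 2 ≤ σ ^ 2 := sq_le_sq' (neg_le_of_abs_le (hrR.trans hRσ))
    ((le_abs_self r).trans (hrR.trans hRσ))
  rw [neg_div, neg_div]
  gcongr

end DensityBound

section NormalComparison

open scoped Matrix

variable {Ω Ω' ι : Type*} {mΩ : MeasurableSpace Ω} {mΩ' : MeasurableSpace Ω'} {P : Measure Ω}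
  {P' : Measure Ω'}

lemma posSemidef_of_covariance [Finite ι] [IsFiniteMeasure P] {X : ι → Ω → ℝ}
    (hX : ∀ i, MemLp (X i) 2 P) : (Matrix.of fun i j => cov[X i, X j; P]).PosSemidef := by
  have := Fintype.ofFinite ι
  refine .of_dotProduct_mulVec_nonneg (Matrix.IsHermitian.ext fun i j => covariance_comm _ _)
    fun c => ?_
  have : star c ⬝ᵥ Matrix.of (fun i j => cov[X i, X j; P]) *ᵥ c =
      Var[fun ω => ∑ i, c i * X i ω; P] := by
    rw [variance_fun_sum fun i => (hX i).const_mul _]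
    simp only [dotProduct, Matrix.mulVec, Matrix.of_apply, star_trivial, Finset.mul_sum,
      covariance_const_mul_left, covariance_const_mul_right]
    exact Finset.sum_congr rfl fun i _ => Finset.sum_congr rfl fun j _ => by ring
  rw [this]
  exact variance_nonneg _ _

variable [Fintype ι]

lemma tendsto_integral_prod_smoothStep (μ : Measure (EuclideanSpace ℝ ι)) [IsFiniteMeasure μ]
    {a b : ι → ℝ} (hab : ∀ i, a i ≤ b i) :
    Tendsto (fun ε => ∫ x, ∏ i, ((smoothStep (a i) ε (x i) - smoothStep (b i) ε (x i) : ℝ) : ℂ) ∂μ)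
      (𝓝[>] 0) (𝓝 (μ.real {x | ∀ i, x i ∈ Set.Ioc (a i) (b i)} : ℂ)) := by
  have measurable_box :
      MeasurableSet {x : EuclideanSpace ℝ ι | ∀ i, x i ∈ Set.Ioc (a i) (b i)} := by
    simp only [Set.ofPred_forall]
    exact MeasurableSet.iInter fun i => measurableSet_Ioc.preimage (by fun_prop)
  have limit (x : EuclideanSpace ℝ ι) :
      ∏ i, (((Set.Ioi (a i)).indicator 1 (x i) - (Set.Ioi (b i)).indicator 1 (x i) : ℝ) : ℂ) =
        ({x : EuclideanSpace ℝ ι | ∀ i, x i ∈ Set.Ioc (a i) (b i)}.indicator 1 x : ℝ) := by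
    have factor (i : ι) : (Set.Ioi (a i)).indicator 1 (x i) - (Set.Ioi (b i)).indicator 1 (x i) =
        if x i ∈ Set.Ioc (a i) (b i) then (1 : ℝ) else 0 := by
      simp only [Set.indicator_apply, Set.mem_Ioi, Set.mem_Ioc, Pi.one_apply]
      grind
    rw [← Complex.ofReal_prod, Finset.prod_congr rfl fun i _ => factor i]
    simp only [Finset.prod_ite_zero, Finset.prod_const_one, Finset.mem_univ, true_imp_iff,
      Set.indicator_apply, Set.mem_ofPred_eq, Pi.one_apply]
  rw [← integral_indicator_one measurable_box, ← integral_complex_ofReal]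
  refine tendsto_integral_filter_of_dominated_convergence (fun _ => 1) ?_ ?_
    (integrable_const _) (ae_of_all _ fun x => ?_)
  · have continuous (c ε : ℝ) : Continuous (smoothStep c ε) :=
      contDiff_smoothStep (n := 0).continuous
    exact Eventually.of_forall fun ε => Continuous.aestronglyMeasurable (by fun_prop)
  · filter_upwards [self_mem_nhdsWithin] with ε hε
    refine ae_of_all _ fun x => ?_
    rw [norm_prod]
    exact Finset.prod_le_one (fun i _ => norm_nonneg _) fun i _ =>
      norm_smoothCutoff_le_one hε (hab i) (x i)
  · rw [← limit]
    exact tendsto_finsetProd _ fun i _ => (Complex.continuous_ofReal.tendsto _).comp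
      ((tendsto_smoothStep (a i) (x i)).sub (tendsto_smoothStep (b i) (x i)))

section Multivariate

variable [DecidableEq ι] {S S₁ S₀ : Matrix ι ι ℝ}

lemma hasGaussianLaw_eval_multivariateGaussian (S : Matrix ι ι ℝ) :
    HasGaussianLaw (fun (x : EuclideanSpace ℝ ι) i => x i) (multivariateGaussian 0 S) :=
  IsGaussian.hasGaussianLaw_id.map_equiv_fun (EuclideanSpace.equiv ι ℝ)

lemma integral_eval_multivariateGaussian_zero (S : Matrix ι ι ℝ) (i : ι) :
    ∫ x, x i ∂(multivariateGaussian 0 S) = 0 := by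
  refine ((EuclideanSpace.proj (𝕜 := ℝ) i).integral_comp_comm
    (IsGaussian.integrable_id (μ := multivariateGaussian 0 S))).trans ?_
  rw [integral_id_multivariateGaussian', map_zero]

lemma map_eval_eval_multivariateGaussian (hS : S.PosSemidef) {i j : ι} (hi : S i i = 1)
    (hj : S j j = 1) (hij : |S i j| ≤ 1) :
    (multivariateGaussian 0 S).map (fun x => (x i, x j)) = bivLaw (S i j) := by
  refine map_prodMk_eq_bivLaw hij
    ((hasGaussianLaw_eval_multivariateGaussian S).prodMk i j)
    (integral_eval_multivariateGaussian_zero S i) (integral_eval_multivariateGaussian_zero S j)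
    ?_ ?_ (covariance_eval_multivariateGaussian hS i j)
  · rw [variance_eval_multivariateGaussian hS, hi]
  · rw [variance_eval_multivariateGaussian hS, hj]

lemma map_eq_map_multivariateGaussian {X : ι → Ω → ℝ}
    (hX : HasGaussianLaw (fun ω i => X i ω) P) (hmean : ∀ i, ∫ ω, X i ω ∂P = 0) :
    P.map (fun ω i => X i ω) =
      (multivariateGaussian 0 (.of fun i j => cov[X i, X j; P])).map
        fun (x : EuclideanSpace ℝ ι) i => x i := by
  have := hX.isProbabilityMeasure
  refine map_eq_map_of_covariance_eq (Y := fun i (x : EuclideanSpace ℝ ι) => x i) hX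
    (hasGaussianLaw_eval_multivariateGaussian _)
    (fun i => by rw [hmean, integral_eval_multivariateGaussian_zero]) fun i j => ?_
  rw [covariance_eval_multivariateGaussian
    (posSemidef_of_covariance fun i => (hX.eval i).memLp_two), Matrix.of_apply]

lemma real_box_eq_multivariateGaussian {X : ι → Ω → ℝ}
    (hX : HasGaussianLaw (fun ω i => X i ω) P) (hmean : ∀ i, ∫ ω, X i ω ∂P = 0) (a b : ι → ℝ) :
    P.real {ω | ∀ k, X k ω ∈ Set.Ioc (a k) (b k)} =
      (multivariateGaussian 0 (.of fun i j => cov[X i, X j; P])).real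
        {x | ∀ k, x k ∈ Set.Ioc (a k) (b k)} := by
  have measurable_box : MeasurableSet {x : ι → ℝ | ∀ k, x k ∈ Set.Ioc (a k) (b k)} := by
    simp only [Set.ofPred_forall]
    exact MeasurableSet.iInter fun i => measurableSet_Ioc.preimage (measurable_pi_apply i)
  have law := congrArg (fun μ => μ.real {x | ∀ k, x k ∈ Set.Ioc (a k) (b k)})
    (map_eq_map_multivariateGaussian hX hmean)
  rwa [map_measureReal_apply_of_aemeasurable hX.aemeasurable measurable_box,
    map_measureReal_apply (by fun_prop) measurable_box] at law

lemma lintegral_enorm_deriv_smoothCutoff_mul_le (hS : S.PosSemidef) {i j : ι} (hi : S i i = 1)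
    (hj : S j j = 1) {R σ : ℝ} (hR : |S i j| ≤ R) (hRσ : R ≤ σ) (hσ : σ < 1) {a b : ι → ℝ}
    {w ε : ℝ} (ha : ∀ k, w ≤ |a k|) (hb : ∀ k, w ≤ |b k|) (hε : 0 < ε) (hab : ∀ k, a k ≤ b k) :
    ∫⁻ x, ‖deriv (smoothCutoff hε (hab i)) (x i)‖ₑ * ‖deriv (smoothCutoff hε (hab j)) (x j)‖ₑ
        ∂(multivariateGaussian 0 S) ≤
      ENNReal.ofReal ((2 * Real.pi * √(1 - σ ^ 2))⁻¹ * Real.exp (-max (w - ε) 0 ^ 2 / (1 + R))) *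
        4 := by
  have hr : |S i j| < 1 := (hR.trans hRσ).trans_lt hσ
  have vanish (k : ι) (x : ℝ) (hx : |x| < max (w - ε) 0) :
      ‖deriv (smoothCutoff hε (hab k)) x‖ₑ = 0 := by
    rw [enorm_eq_zero]
    exact deriv_smoothCutoff_eq_zero hε (hab k) (ha k) (hb k)
      ((lt_max_iff.1 hx).resolve_right (abs_nonneg x).not_gt)
  calc _ = ∫⁻ p, ‖deriv (smoothCutoff hε (hab i)) p.1‖ₑ * ‖deriv (smoothCutoff hε (hab j)) p.2‖ₑ
          ∂(bivLaw (S i j)) := by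
        rw [← map_eval_eval_multivariateGaussian hS hi hj hr.le,
          lintegral_map (by fun_prop) (by fun_prop)]
    _ ≤ _ := (lintegral_mul_bivLaw_le hr (le_max_right _ _) (by fun_prop) (by fun_prop)
        (vanish i) (vanish j))
    _ ≤ _ := by
        refine mul_le_mul' (ENNReal.ofReal_le_ofReal (density_bound_mono hR hRσ hσ)) ?_
        refine (mul_le_mul' (lintegral_enorm_deriv_smoothCutoff_le hε (hab i))
          (lintegral_enorm_deriv_smoothCutoff_le hε (hab j))).trans_eq ?_
        norm_num

lemma norm_integral_prod_smoothCutoff_sub_le (hS₁ : S₁.PosSemidef) (hS₀ : S₀.PosSemidef)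
    (hd₁ : ∀ i, S₁ i i = 1) (hd₀ : ∀ i, S₀ i i = 1) {σ : ℝ} (hσ : σ < 1)
    (hSσ : ∀ i j, S₁ i j ≠ S₀ i j → max |S₁ i j| |S₀ i j| ≤ σ) {a b : ι → ℝ} {w ε : ℝ}
    (ha : ∀ k, w ≤ |a k|) (hb : ∀ k, w ≤ |b k|) (hε : 0 < ε) (hab : ∀ k, a k ≤ b k) :
    ‖∫ x, ∏ k, smoothCutoff hε (hab k) (x k) ∂(multivariateGaussian 0 S₁) -
        ∫ x, ∏ k, smoothCutoff hε (hab k) (x k) ∂(multivariateGaussian 0 S₀)‖ ≤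
      (Real.pi * √(1 - σ ^ 2))⁻¹ * ∑ i, ∑ j, |S₁ i j - S₀ i j| *
        Real.exp (-max (w - ε) 0 ^ 2 / (1 + max |S₁ i j| |S₀ i j|)) := by
  set B : ι → ι → ℝ := fun i j => (2 * Real.pi * √(1 - σ ^ 2))⁻¹ *
    Real.exp (-max (w - ε) 0 ^ 2 / (1 + max |S₁ i j| |S₀ i j|)) with hB
  have B_nonneg (i j : ι) : 0 ≤ B i j := by positivity
  have bound := norm_integral_prod_sub_integral_prod_le hS₁ hS₀ (fun i => by rw [hd₁, hd₀])
    (fun k => norm_smoothCutoff_le_one hε (hab k)) (B := fun i j => (B i j).toNNReal * 4)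
    fun i j _ hne t ht => ?_
  · refine bound.trans_eq ?_
    simp only [Finset.mul_sum]
    refine Finset.sum_congr rfl fun i _ => Finset.sum_congr rfl fun j _ => ?_
    rw [NNReal.coe_mul, Real.coe_toNNReal _ (B_nonneg i j), NNReal.coe_ofNat, hB]
    ring
  · have apply_eq (k l : ι) : (t • S₁ + (1 - t) • S₀) k l = t * S₁ k l + (1 - t) * S₀ k l := rfl
    have diag (k : ι) : (t • S₁ + (1 - t) • S₀) k k = 1 := by
      rw [apply_eq, hd₁, hd₀]
      ring
    have entry_le : |(t • S₁ + (1 - t) • S₀) i j| ≤ max |S₁ i j| |S₀ i j| := by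
      calc |(t • S₁ + (1 - t) • S₀) i j| ≤ t * |S₁ i j| + (1 - t) * |S₀ i j| := by
            rw [apply_eq]
            refine (abs_add_le _ _).trans_eq ?_
            rw [abs_mul, abs_mul, abs_of_nonneg ht.1, abs_of_nonneg (sub_nonneg.2 ht.2)]
        _ ≤ max |S₁ i j| |S₀ i j| :=
            (Convex.combo_le_max _ _ ht.1 (sub_nonneg.2 ht.2) (add_sub_cancel t 1))
    exact lintegral_enorm_deriv_smoothCutoff_mul_le (posSemidef_interpolation hS₁ hS₀ ht)
      (diag i) (diag j) entry_le (hSσ i j hne) hσ ha hb hε hab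

lemma abs_multivariateGaussian_real_box_sub_le (hS₁ : S₁.PosSemidef) (hS₀ : S₀.PosSemidef)
    (hd₁ : ∀ i, S₁ i i = 1) (hd₀ : ∀ i, S₀ i i = 1) {σ : ℝ} (hσ : σ < 1)
    (hSσ : ∀ i j, S₁ i j ≠ S₀ i j → max |S₁ i j| |S₀ i j| ≤ σ) {a b : ι → ℝ} {w : ℝ}
    (hw : 0 ≤ w) (ha : ∀ k, w ≤ |a k|) (hb : ∀ k, w ≤ |b k|) (hab : ∀ k, a k ≤ b k) :
    |(multivariateGaussian 0 S₁).real {x | ∀ k, x k ∈ Set.Ioc (a k) (b k)} -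
        (multivariateGaussian 0 S₀).real {x | ∀ k, x k ∈ Set.Ioc (a k) (b k)}| ≤
      (Real.pi * √(1 - σ ^ 2))⁻¹ * ∑ i, ∑ j, |S₁ i j - S₀ i j| *
        Real.exp (-w ^ 2 / (1 + max |S₁ i j| |S₀ i j|)) := by
  have lhs := ((tendsto_integral_prod_smoothStep (multivariateGaussian 0 S₁) hab).sub
    (tendsto_integral_prod_smoothStep (multivariateGaussian 0 S₀) hab)).norm
  rw [← Complex.ofReal_sub, Complex.norm_real, Real.norm_eq_abs] at lhs
  have rhs : Tendsto (fun ε => (Real.pi * √(1 - σ ^ 2))⁻¹ * ∑ i, ∑ j, |S₁ i j - S₀ i j| *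
      Real.exp (-max (w - ε) 0 ^ 2 / (1 + max |S₁ i j| |S₀ i j|))) (𝓝[>] 0)
      (𝓝 ((Real.pi * √(1 - σ ^ 2))⁻¹ * ∑ i, ∑ j, |S₁ i j - S₀ i j| *
        Real.exp (-max (w - 0) 0 ^ 2 / (1 + max |S₁ i j| |S₀ i j|)))) :=
    (Continuous.tendsto (by fun_prop) 0).mono_left nhdsWithin_le_nhds
  rw [sub_zero, max_eq_left hw] at rhs
  refine le_of_tendsto_of_tendsto lhs rhs ?_
  filter_upwards [self_mem_nhdsWithin] with ε hε
  exact norm_integral_prod_smoothCutoff_sub_le hS₁ hS₀ hd₁ hd₀ hσ hSσ ha hb hε hab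

end Multivariate

theorem normal_comparison {X : ι → Ω → ℝ} {Y : ι → Ω' → ℝ}
    (hX : HasGaussianLaw (fun ω i => X i ω) P) (hY : HasGaussianLaw (fun ω i => Y i ω) P')
    (hX₀ : ∀ i, ∫ ω, X i ω ∂P = 0) (hY₀ : ∀ i, ∫ ω, Y i ω ∂P' = 0)
    (hX₁ : ∀ i, Var[X i; P] = 1) (hY₁ : ∀ i, Var[Y i; P'] = 1) {σ : ℝ} (hσ : σ < 1)
    (hcov : ∀ i j, cov[X i, X j; P] ≠ cov[Y i, Y j; P'] →
      max |cov[X i, X j; P]| |cov[Y i, Y j; P']| ≤ σ)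
    {a b : ι → ℝ} {w : ℝ} (hw : 0 ≤ w) (ha : ∀ k, w ≤ |a k|) (hb : ∀ k, w ≤ |b k|)
    (hab : ∀ k, a k ≤ b k) :
    |P.real {ω | ∀ k, X k ω ∈ Set.Ioc (a k) (b k)} -
        P'.real {ω | ∀ k, Y k ω ∈ Set.Ioc (a k) (b k)}| ≤
      (Real.pi * √(1 - σ ^ 2))⁻¹ * ∑ i, ∑ j, |cov[X i, X j; P] - cov[Y i, Y j; P']| *
        Real.exp (-w ^ 2 / (1 + max |cov[X i, X j; P]| |cov[Y i, Y j; P']|)) := by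
  classical
  have := hX.isProbabilityMeasure
  have := hY.isProbabilityMeasure
  rw [real_box_eq_multivariateGaussian hX hX₀, real_box_eq_multivariateGaussian hY hY₀]
  exact abs_multivariateGaussian_real_box_sub_le
    (posSemidef_of_covariance fun i => (hX.eval i).memLp_two)
    (posSemidef_of_covariance fun i => (hY.eval i).memLp_two)
    (fun i => (covariance_self (hX.eval i).aemeasurable).trans (hX₁ i))
    (fun i => (covariance_self (hY.eval i).aemeasurable).trans (hY₁ i)) hσ hcov hw ha hb hab

end NormalComparison

section Levels

/-- The constant `κ_n = √(2 ln n) b_n`, for which `√(2 ln n) u_n(z) = z + κ_n`. -/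
noncomputable def levelShift (n : ℕ) : ℝ :=
  2 * Real.log n - 1 / 2 * Real.log (4 * Real.pi * Real.log n)

lemma tendsto_log_natCast : Tendsto (fun n : ℕ => Real.log n) atTop atTop :=
  Real.tendsto_log_atTop.comp tendsto_natCast_atTop_atTop

lemma tendsto_log_log_div_sqrt_log :
    Tendsto (fun n : ℕ => Real.log (4 * Real.pi * Real.log n) / √(Real.log n)) atTop (𝓝 0) := by
  have inner : Tendsto (fun n : ℕ => 4 * Real.pi * Real.log n) atTop atTop :=
    tendsto_log_natCast.const_mul_atTop (by positivity)
  have ratio := ((isLittleO_log_rpow_atTop one_half_pos).tendsto_div_nhds_zero.comp inner).mul_const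
    √(4 * Real.pi)
  rw [zero_mul] at ratio
  refine ratio.congr fun n => ?_
  have : 0 < √(4 * Real.pi) := Real.sqrt_pos.2 (by positivity)
  rw [Function.comp_apply, ← Real.sqrt_eq_rpow, Real.sqrt_mul (by positivity)]
  field_simp

lemma tendsto_levelShift_div_log :
    Tendsto (fun n : ℕ => levelShift n / Real.log n) atTop (𝓝 2) := by
  have correction := (tendsto_log_log_div_sqrt_log.div_atTop
    (Real.tendsto_sqrt_atTop.comp tendsto_log_natCast)).const_mul (1 / 2)
  have := correction.const_sub 2
  rw [mul_zero, sub_zero] at this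
  refine this.congr' ?_
  filter_upwards [tendsto_log_natCast.eventually_gt_atTop 0] with n hn
  rw [Function.comp_apply, div_div, Real.mul_self_sqrt hn.le, levelShift]
  field_simp

variable {n : ℕ}

lemma log_natCast_pos (hn : 2 ≤ n) : 0 < Real.log n :=
  Real.log_pos (by exact_mod_cast hn)

lemma sqrt_two_log_pos (hn : 2 ≤ n) : 0 < √(2 * Real.log n) :=
  Real.sqrt_pos.2 (mul_pos two_pos (log_natCast_pos hn))

lemma scaleConst_pos (hn : 2 ≤ n) : 0 < scaleConst n :=
  one_div_pos.2 (sqrt_two_log_pos hn)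

lemma sqrt_mul_normLevel (hn : 2 ≤ n) (z : ℝ) :
    √(2 * Real.log n) * normLevel n z = z + levelShift n := by
  have := sqrt_two_log_pos hn
  have sq : √(2 * Real.log n) ^ 2 = 2 * Real.log n :=
    Real.sq_sqrt (mul_pos two_pos (log_natCast_pos hn)).le
  rw [normLevel, scaleConst, locConst, levelShift]
  field_simp
  rw [sq]
  ring

lemma normLevel_strictMono (hn : 2 ≤ n) : StrictMono (normLevel n) := fun a b hab => by
  simpa [normLevel] using mul_lt_mul_of_pos_left hab (scaleConst_pos hn)

lemma normLevel_sq (hn : 2 ≤ n) (z : ℝ) :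
    normLevel n z ^ 2 = (z + levelShift n) ^ 2 / (2 * Real.log n) := by
  have := log_natCast_pos hn
  rw [eq_div_iff (by positivity), ← sqrt_mul_normLevel hn, mul_pow,
    Real.sq_sqrt (by positivity), mul_comm]

/-- The density of `n` times the law of `(ξ - b_n) / a_n`, for `ξ` a standard normal variable. -/
noncomputable def exceedanceDensity (n : ℕ) (z : ℝ) : ℝ :=
  n * (scaleConst n * gaussianPDFReal 0 1 (normLevel n z))

lemma exceedanceDensity_eq (hn : 2 ≤ n) (z : ℝ) :
    exceedanceDensity n z =
      Real.exp (-z) * Real.exp (-(z + levelShift n - 2 * Real.log n) ^ 2 / (4 * Real.log n)) := by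
  have log_pos := log_natCast_pos hn
  have := sqrt_two_log_pos hn
  have cast_pos : (0 : ℝ) < n := by positivity
  have exp_half : Real.exp (1 / 2 * Real.log (4 * Real.pi * Real.log n)) =
      √(2 * Real.pi) * √(2 * Real.log n) := by
    rw [← Real.sqrt_mul (by positivity), Real.sqrt_eq_rpow, Real.rpow_def_of_pos (by positivity)]
    ring_nf
  have exponent : -((z + levelShift n) ^ 2 / (2 * Real.log n)) / 2 =
      -z + -(z + levelShift n - 2 * Real.log n) ^ 2 / (4 * Real.log n) +
        (1 / 2 * Real.log (4 * Real.pi * Real.log n) + -Real.log n) := by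
    rw [levelShift]
    field_simp
    ring
  have : 0 < √(2 * Real.pi) := by positivity
  rw [exceedanceDensity, gaussianPDFReal, scaleConst, NNReal.coe_one, mul_one, mul_one, sub_zero,
    normLevel_sq hn, exponent, Real.exp_add, Real.exp_add, Real.exp_add _ (-Real.log n), exp_half,
    Real.exp_neg (Real.log n), Real.exp_log cast_pos]
  field_simp

lemma exceedanceDensity_nonneg (n : ℕ) (z : ℝ) : 0 ≤ exceedanceDensity n z :=
  mul_nonneg n.cast_nonneg (mul_nonneg (by unfold scaleConst; positivity)
    (gaussianPDFReal_nonneg _ _ _))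

lemma exceedanceDensity_le_exp_neg (hn : 2 ≤ n) (z : ℝ) :
    exceedanceDensity n z ≤ Real.exp (-z) := by
  have := log_natCast_pos hn
  rw [exceedanceDensity_eq hn, neg_div]
  exact mul_le_of_le_one_right (Real.exp_pos _).le
    (Real.exp_le_one_iff.2 (neg_nonpos.2 (by positivity)))

lemma tendsto_exceedanceDensity (z : ℝ) :
    Tendsto (fun n => exceedanceDensity n z) atTop (𝓝 (Real.exp (-z))) := by
  have deviation : Tendsto (fun n : ℕ => (z + levelShift n - 2 * Real.log n) / √(Real.log n))
      atTop (𝓝 0) := by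
    have := (tendsto_const_nhds.div_atTop
      (Real.tendsto_sqrt_atTop.comp tendsto_log_natCast) (a := z)).sub
        (tendsto_log_log_div_sqrt_log.const_mul (1 / 2))
    rw [mul_zero, sub_zero] at this
    refine this.congr fun n => ?_
    rw [levelShift, Function.comp_apply]
    ring
  have exponent := ((deviation.pow 2).div_const 4).neg.rexp.const_mul (Real.exp (-z))
  rw [zero_pow two_ne_zero, zero_div, neg_zero, Real.exp_zero, mul_one] at exponent
  refine exponent.congr' ?_
  filter_upwards [eventually_ge_atTop 2] with n hn
  rw [exceedanceDensity_eq hn, div_pow, Real.sq_sqrt (log_natCast_pos hn).le, div_div, neg_div,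
    mul_comm (Real.log n)]

lemma natCast_mul_integral_gaussianReal (hn : 2 ≤ n) (f : ℝ → ℝ) :
    n * ∫ t, f t ∂(gaussianReal 0 1) = ∫ z, exceedanceDensity n z * f (normLevel n z) := by
  have pos := scaleConst_pos hn
  have substitution := Measure.integral_comp_mul_left
    (fun t => gaussianPDFReal 0 1 (t + locConst n) * f (t + locConst n)) (scaleConst n)
  rw [integral_add_right_eq_self (μ := volume) (fun t => gaussianPDFReal 0 1 t * f t),
    abs_of_pos (inv_pos.2 pos), smul_eq_mul, eq_inv_mul_iff_mul_eq₀ pos.ne'] at substitution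
  rw [integral_gaussianReal_eq_integral_smul one_ne_zero]
  simp only [smul_eq_mul]
  rw [← substitution, ← integral_const_mul, ← integral_const_mul]
  simp only [exceedanceDensity, normLevel, mul_assoc]

end Levels

section Tail

lemma tendsto_measureReal_of_ae_eventually_iff {α : Type*} [MeasurableSpace α] {μ : Measure α}
    [IsFiniteMeasure μ] {A : ℕ → Set α} {B : Set α} (hA : ∀ n, MeasurableSet (A n))
    (hB : MeasurableSet B) (h : ∀ᵐ w ∂μ, ∀ᶠ n in atTop, (w ∈ A n ↔ w ∈ B)) :
    Tendsto (fun n => μ.real (A n)) atTop (𝓝 (μ.real B)) :=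
  (ENNReal.tendsto_toReal (measure_ne_top _ _)).comp
    (tendsto_measure_of_ae_tendsto_indicator_of_isFiniteMeasure atTop hB hA h)

lemma bivLaw_real_eq_integral (r : ℝ) {S : Set (ℝ × ℝ)} (hS : MeasurableSet S) :
    (bivLaw r).real S = ∫ t, (gaussianReal 0 1).real {w | (t, r * t + √(1 - r ^ 2) * w) ∈ S}
      ∂(gaussianReal 0 1) := by
  have hS' := measurable_bivLaw_map r hS
  rw [bivLaw, map_measureReal_apply (measurable_bivLaw_map r) hS, measureReal_def,
    Measure.prod_apply hS']
  exact (integral_toReal (measurable_measure_prodMk_left hS').aemeasurable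
    (ae_of_all _ fun _ => measure_lt_top _ _)).symm

lemma natCast_mul_bivLaw_real {n : ℕ} (hn : 2 ≤ n) (r : ℝ) {x : ℝ} {S : Set (ℝ × ℝ)}
    (hS : MeasurableSet S) (hSx : ∀ p ∈ S, normLevel n x ≤ p.1) :
    n * (bivLaw r).real S = ∫ z in Set.Ioi x, exceedanceDensity n z *
      (gaussianReal 0 1).real {w | (normLevel n z, r * normLevel n z + √(1 - r ^ 2) * w) ∈ S} := by
  rw [bivLaw_real_eq_integral r hS, natCast_mul_integral_gaussianReal hn,
    ← integral_Ici_eq_integral_Ioi, setIntegral_eq_integral_of_forall_compl_eq_zero]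
  intro z hz
  have empty : {w | (normLevel n z, r * normLevel n z + √(1 - r ^ 2) * w) ∈ S} = ∅ :=
    Set.eq_empty_of_forall_notMem fun w hw =>
      (hSx _ hw).not_gt (normLevel_strictMono hn (not_le.1 hz))
  rw [empty, measureReal_empty, mul_zero]

lemma tendsto_natCast_mul_bivLaw_real {ρ : ℕ → ℝ} {x : ℝ} {S : ℕ → Set (ℝ × ℝ)}
    (hS : ∀ n, MeasurableSet (S n)) (hSx : ∀ n, ∀ p ∈ S n, normLevel n x ≤ p.1) {B : ℝ → Set ℝ}
    (hB : ∀ z, MeasurableSet (B z))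
    (h : ∀ᵐ z ∂(volume.restrict (Set.Ioi x)), ∀ᵐ w ∂(gaussianReal 0 1), ∀ᶠ n in atTop,
      ((normLevel n z, ρ n * normLevel n z + √(1 - ρ n ^ 2) * w) ∈ S n ↔ w ∈ B z)) :
    Tendsto (fun n : ℕ => n * (bivLaw (ρ n)).real (S n)) atTop
      (𝓝 (∫ z in Set.Ioi x, Real.exp (-z) * (gaussianReal 0 1).real (B z))) := by
  have hS' (n : ℕ) := measurable_bivLaw_map (ρ n) (hS n)
  have measurable_level (n : ℕ) : Measurable (normLevel n) := by unfold normLevel; fun_prop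
  refine (tendsto_integral_filter_of_dominated_convergence (fun z => Real.exp (-z)) ?_ ?_
    (integrableOn_exp_neg_Ioi x) ?_).congr' ?_ (f₁ := fun n => ∫ z in Set.Ioi x,
      exceedanceDensity n z * (gaussianReal 0 1).real
        {w | (normLevel n z, ρ n * normLevel n z + √(1 - ρ n ^ 2) * w) ∈ S n})
  · refine Eventually.of_forall fun n => Measurable.aestronglyMeasurable (Measurable.mul ?_ ?_)
    · exact ((measurable_gaussianPDFReal 0 1).comp (measurable_level n)).const_mul _ |>.const_mul _
    · exact (measurable_measure_prodMk_left (hS' n)).ennreal_toReal.comp (measurable_level n)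
  · filter_upwards [eventually_ge_atTop 2] with n hn
    refine ae_of_all _ fun z => ?_
    rw [Real.norm_of_nonneg (mul_nonneg (exceedanceDensity_nonneg n z) measureReal_nonneg)]
    exact (mul_le_of_le_one_right (exceedanceDensity_nonneg n z) measureReal_le_one).trans
      (exceedanceDensity_le_exp_neg hn z)
  · filter_upwards [h] with z hz
    exact (tendsto_exceedanceDensity z).mul
      (tendsto_measureReal_of_ae_eventually_iff (fun n => measurable_prodMk_left (hS' n)) (hB z) hz)
  · filter_upwards [eventually_ge_atTop 2] with n hn
    exact (natCast_mul_bivLaw_real hn (ρ n) (hS n) (hSx n)).symm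

end Tail

section HuslerReiss

/-- Up to its boundary, the set of `w` such that `ρ u_n(z) + √(1 - ρ²) w < u_n(y)` for large `n`,
where `(1 - ρ) ln n → λ²`. -/
def conditionalRegion (lam : ℝ≥0∞) (y z : ℝ) : Set ℝ :=
  {w | lam = ⊤ ∨ 2 * lam.toReal * w ≤ y - z + 2 * lam.toReal ^ 2}

/-- The limit of `n ℙ(ξ₁ > u_n(x), ξ₂ ≤ u_n(y))` for a standard normal pair `(ξ₁, ξ₂)` with
correlation `ρ(n)` such that `(1 - ρ(n)) ln n → λ²`. -/
noncomputable def tailLimit (lam : ℝ≥0∞) (x y : ℝ) : ℝ :=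
  ∫ z in Set.Ioi x, Real.exp (-z) * (gaussianReal 0 1).real (conditionalRegion lam y z)

lemma hasDerivAt_stdNormalCDF (x : ℝ) : HasDerivAt stdNormalCDF (gaussianPDFReal 0 1 x) x := by
  have integrable : Integrable (gaussianPDFReal 0 1) := integrable_gaussianPDFReal 0 1
  have continuous_pdf : Continuous (gaussianPDFReal 0 1) := by
    rw [gaussianPDFReal_def]
    fun_prop
  have eq_integral (y : ℝ) : stdNormalCDF y = ∫ t in Set.Iic y, gaussianPDFReal 0 1 t := by
    rw [stdNormalCDF, cdf_eq_real, measureReal_def, gaussianReal_apply_eq_integral _ one_ne_zero,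
      ENNReal.toReal_ofReal (integral_nonneg fun t => gaussianPDFReal_nonneg _ _ _)]
  have primitive : stdNormalCDF =
      fun y => stdNormalCDF 0 + ∫ t in (0 : ℝ)..y, gaussianPDFReal 0 1 t := by
    ext y
    rw [eq_integral, eq_integral, ← intervalIntegral.integral_Iic_sub_Iic
      integrable.integrableOn integrable.integrableOn, add_sub_cancel]
  rw [primitive]
  exact (continuous_pdf.integral_hasStrictDerivAt 0 x).hasDerivAt.const_add _

lemma continuous_stdNormalCDF : Continuous stdNormalCDF :=
  continuous_iff_continuousAt.2 fun x => (hasDerivAt_stdNormalCDF x).continuousAt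

lemma stdNormalCDF_nonneg (x : ℝ) : 0 ≤ stdNormalCDF x := cdf_nonneg _ _

lemma stdNormalCDF_le_one (x : ℝ) : stdNormalCDF x ≤ 1 := cdf_le_one _ _

section Finite

variable {l : ℝ} (hl : 0 < l) (x y z : ℝ)
include hl

lemma exp_mul_gaussianPDFReal_symm :
    Real.exp (-z) * gaussianPDFReal 0 1 (l + (y - z) / (2 * l)) =
      Real.exp (-y) * gaussianPDFReal 0 1 (l + (z - y) / (2 * l)) := by
  simp only [gaussianPDFReal]
  rw [mul_left_comm, mul_left_comm (Real.exp (-y)), ← Real.exp_add, ← Real.exp_add, NNReal.coe_one]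
  congr 2
  field_simp
  ring

/-- An antiderivative, found by integrating by parts: by `exp_mul_gaussianPDFReal_symm` the
remaining integrand is again a normal density. -/
lemma hasDerivAt_exp_mul_stdNormalCDF :
    HasDerivAt (fun z => -(Real.exp (-z) * stdNormalCDF (l + (y - z) / (2 * l))) -
        Real.exp (-y) * stdNormalCDF (l + (z - y) / (2 * l)))
      (Real.exp (-z) * stdNormalCDF (l + (y - z) / (2 * l))) z := by
  have inner₁ : HasDerivAt (fun z => l + (y - z) / (2 * l)) (-1 / (2 * l)) z :=
    (((hasDerivAt_id z).const_sub y).div_const (2 * l)).const_add l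
  have inner₂ : HasDerivAt (fun z => l + (z - y) / (2 * l)) (1 / (2 * l)) z :=
    (((hasDerivAt_id z).sub_const y).div_const (2 * l)).const_add l
  refine (((hasDerivAt_neg z).exp.mul ((hasDerivAt_stdNormalCDF _).comp z inner₁)).neg.sub
    (((hasDerivAt_stdNormalCDF _).comp z inner₂).const_mul (Real.exp (-y)))).congr_deriv ?_
  rw [Function.comp_apply]
  linear_combination (1 / (2 * l)) * exp_mul_gaussianPDFReal_symm hl y z

lemma integral_exp_mul_stdNormalCDF :
    ∫ z in Set.Ioi x, Real.exp (-z) * stdNormalCDF (l + (y - z) / (2 * l)) =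
      stdNormalCDF (l + (x - y) / (2 * l)) * Real.exp (-y) +
        stdNormalCDF (l + (y - x) / (2 * l)) * Real.exp (-x) - Real.exp (-y) := by
  have integrable : IntegrableOn
      (fun z => Real.exp (-z) * stdNormalCDF (l + (y - z) / (2 * l))) (Set.Ioi x) := by
    have := continuous_stdNormalCDF
    refine (integrableOn_exp_neg_Ioi x).mul_bdd (c := 1)
      (Continuous.aestronglyMeasurable (by fun_prop)) (ae_of_all _ fun z => ?_)
    rw [Real.norm_of_nonneg (stdNormalCDF_nonneg _)]
    exact stdNormalCDF_le_one _
  have vanish : Tendsto (fun z => Real.exp (-z) * stdNormalCDF (l + (y - z) / (2 * l)))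
      atTop (𝓝 0) :=
    squeeze_zero (fun z => mul_nonneg (Real.exp_pos _).le (stdNormalCDF_nonneg _))
      (fun z => mul_le_of_le_one_right (Real.exp_pos _).le (stdNormalCDF_le_one _))
      Real.tendsto_exp_neg_atTop_nhds_zero
  have argument : Tendsto (fun z => l + (z - y) / (2 * l)) atTop atTop :=
    tendsto_atTop_add_const_left _ _
      ((tendsto_atTop_add_const_right _ (-y) tendsto_id).atTop_div_const (by positivity))
  have limit := vanish.neg.sub
    (((tendsto_cdf_atTop (gaussianReal 0 1)).comp argument).const_mul (Real.exp (-y)))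
  rw [integral_Ioi_of_hasDerivAt_of_tendsto'
    (fun z _ => hasDerivAt_exp_mul_stdNormalCDF hl y z) integrable limit]
  ring

end Finite

lemma conditionalRegion_eq_Iic {lam : ℝ≥0∞} (h₀ : lam ≠ 0) (h : lam ≠ ⊤) (y z : ℝ) :
    conditionalRegion lam y z = Set.Iic (lam.toReal + (y - z) / (2 * lam.toReal)) := by
  have pos := ENNReal.toReal_pos h₀ h
  ext w
  have : lam.toReal + (y - z) / (2 * lam.toReal) =
      (y - z + 2 * lam.toReal ^ 2) / (2 * lam.toReal) := by
    field_simp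
    ring
  rw [Set.mem_Iic, this, le_div_iff₀ (by positivity), mul_comm]
  exact or_iff_right h

lemma tailLimit_of_ne {lam : ℝ≥0∞} (h₀ : lam ≠ 0) (h : lam ≠ ⊤) (x y : ℝ) :
    tailLimit lam x y =
      stdNormalCDF (lam.toReal + (x - y) / (2 * lam.toReal)) * Real.exp (-y) +
        stdNormalCDF (lam.toReal + (y - x) / (2 * lam.toReal)) * Real.exp (-x) -
          Real.exp (-y) := by
  rw [← integral_exp_mul_stdNormalCDF (ENNReal.toReal_pos h₀ h), tailLimit]
  simp only [conditionalRegion_eq_Iic h₀ h, stdNormalCDF, cdf_eq_real]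

lemma tailLimit_top (x y : ℝ) : tailLimit ⊤ x y = Real.exp (-x) := by
  rw [← integral_exp_neg_Ioi x]
  simp only [tailLimit, conditionalRegion, true_or, Set.ofPred_true, probReal_univ, mul_one]

lemma tailLimit_zero (x y : ℝ) : tailLimit 0 x y = max (Real.exp (-x)) (Real.exp (-y)) -
    Real.exp (-y) := by
  have integrand (z : ℝ) : Real.exp (-z) * (gaussianReal 0 1).real (conditionalRegion 0 y z) =
      (Set.Iic y).indicator (fun z => Real.exp (-z)) z := by
    by_cases hz : z ≤ y <;> simp [conditionalRegion, hz]
  simp only [tailLimit, integrand]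
  rw [setIntegral_indicator measurableSet_Iic, Set.Ioi_inter_Iic]
  rcases le_total x y with hxy | hxy
  · rw [← intervalIntegral.integral_of_le hxy, max_eq_left (by gcongr)]
    simp
  · rw [Set.Ioc_eq_empty hxy.not_gt, max_eq_right (by gcongr)]
    simp

lemma huslerReissCDF_eq_exp (lam : ℝ≥0∞) (x y : ℝ) :
    huslerReissCDF lam x y = Real.exp (-(Real.exp (-y) + tailLimit lam x y)) := by
  rcases eq_or_ne lam 0 with rfl | h₀
  · rw [huslerReissCDF, if_pos rfl, tailLimit_zero, add_sub_cancel, gumbelCDF, gumbelCDF,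
      ← Real.exp_monotone.map_min, min_neg_neg]
  rcases eq_or_ne lam ⊤ with rfl | h
  · rw [huslerReissCDF, if_neg h₀, if_pos rfl, tailLimit_top, gumbelCDF, gumbelCDF, ← Real.exp_add]
    ring_nf
  · rw [huslerReissCDF, if_neg h₀, if_neg h, tailLimit_of_ne h₀ h]
    ring_nf

end HuslerReiss

section ConditionalExceedance

lemma conditional_lt_iff {n : ℕ} (hn : 2 ≤ n) (r z w y : ℝ) :
    r * normLevel n z + √(1 - r ^ 2) * w < normLevel n y ↔
      √(2 * Real.log n * (1 - r ^ 2)) * w + r * z - y - (1 - r) * levelShift n < 0 := by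
  have scaled : √(2 * Real.log n) * (r * normLevel n z + √(1 - r ^ 2) * w - normLevel n y) =
      √(2 * Real.log n * (1 - r ^ 2)) * w + r * z - y - (1 - r) * levelShift n := by
    rw [Real.sqrt_mul (mul_pos two_pos (log_natCast_pos hn)).le (1 - r ^ 2)]
    linear_combination r * sqrt_mul_normLevel hn z - sqrt_mul_normLevel hn y
  have hpos := sqrt_two_log_pos hn
  rw [← scaled]
  exact ⟨fun h => mul_neg_of_pos_of_neg hpos (sub_neg.2 h),
    fun h => sub_neg.1 (neg_of_mul_neg_right h hpos.le)⟩

variable {ρ : ℕ → ℝ}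

lemma eventually_conditional_lt (hρ : ∀ᶠ n in atTop, |ρ n| ≤ 1)
    (h : Tendsto (fun n : ℕ => (1 - ρ n) * Real.log n) atTop atTop) (z w y : ℝ) :
    ∀ᶠ n in atTop, ρ n * normLevel n z + √(1 - ρ n ^ 2) * w < normLevel n y := by
  filter_upwards [hρ, eventually_ge_atTop 2,
    tendsto_levelShift_div_log.eventually_const_lt one_lt_two,
    h.eventually_gt_atTop (2 * (|z| + |y|) + 16 * w ^ 2)] with n hr hn hshift hτ
  have log_pos := log_natCast_pos hn
  rw [conditional_lt_iff hn]
  set τ := (1 - ρ n) * Real.log n with τ_def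
  have hτ₀ : 0 < τ := lt_of_le_of_lt (by positivity) hτ
  obtain ⟨-, hr'⟩ := abs_le.1 hr
  have coefficient : √(2 * Real.log n * (1 - ρ n ^ 2)) ≤ 2 * √τ := by
    refine Real.sqrt_le_iff.2 ⟨by positivity, ?_⟩
    calc 2 * Real.log n * (1 - ρ n ^ 2) = 2 * (1 + ρ n) * τ := by rw [τ_def]; ring
      _ ≤ 4 * τ := by gcongr; linarith
      _ = (2 * √τ) ^ 2 := by rw [mul_pow, Real.sq_sqrt hτ₀.le]; ring
  have noise : √(2 * Real.log n * (1 - ρ n ^ 2)) * w ≤ τ / 4 + 4 * w ^ 2 := by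
    calc √(2 * Real.log n * (1 - ρ n ^ 2)) * w
        ≤ √(2 * Real.log n * (1 - ρ n ^ 2)) * |w| := by gcongr; exact le_abs_self w
      _ ≤ 2 * √τ * |w| := by gcongr
      _ ≤ √τ ^ 2 / 4 + 4 * |w| ^ 2 := by linarith [sq_nonneg (√τ / 2 - 2 * |w|)]
      _ = τ / 4 + 4 * w ^ 2 := by rw [Real.sq_sqrt hτ₀.le, sq_abs]
  have level : ρ n * z ≤ |z| := (le_abs_self _).trans <| by
    rw [abs_mul]
    exact mul_le_of_le_one_left (abs_nonneg _) hr
  have drift : τ ≤ (1 - ρ n) * levelShift n :=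
    mul_le_mul_of_nonneg_left ((one_lt_div log_pos).1 hshift).le (by linarith)
  linarith [neg_abs_le y, sq_nonneg w]

lemma tendsto_one_of_tendsto_one_sub_mul_log {c : ℝ}
    (h : Tendsto (fun n : ℕ => (1 - ρ n) * Real.log n) atTop (𝓝 c)) :
    Tendsto ρ atTop (𝓝 1) := by
  have := (h.div_atTop tendsto_log_natCast).const_sub 1
  rw [sub_zero] at this
  refine this.congr' ?_
  filter_upwards [eventually_ge_atTop 2] with n hn
  rw [mul_div_cancel_right₀ _ (log_natCast_pos hn).ne', sub_sub_cancel]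

lemma tendsto_conditional_threshold {l : ℝ} (hl : 0 ≤ l)
    (h : Tendsto (fun n : ℕ => (1 - ρ n) * Real.log n) atTop (𝓝 (l ^ 2))) (z w y : ℝ) :
    Tendsto (fun n : ℕ => √(2 * Real.log n * (1 - ρ n ^ 2)) * w + ρ n * z - y -
      (1 - ρ n) * levelShift n) atTop (𝓝 (2 * l * w + 1 * z - y - l ^ 2 * 2)) := by
  have hρ := tendsto_one_of_tendsto_one_sub_mul_log h
  have drift : Tendsto (fun n : ℕ => (1 - ρ n) * levelShift n) atTop (𝓝 (l ^ 2 * 2)) := by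
    refine (h.mul tendsto_levelShift_div_log).congr' ?_
    filter_upwards [eventually_ge_atTop 2] with n hn
    rw [mul_assoc, mul_div_cancel₀ _ (log_natCast_pos hn).ne']
  have coefficient : Tendsto (fun n : ℕ => √(2 * Real.log n * (1 - ρ n ^ 2))) atTop
      (𝓝 (2 * l)) := by
    have := ((h.const_mul 2).mul (hρ.const_add 1)).sqrt
    rw [show 2 * l ^ 2 * (1 + 1) = (2 * l) ^ 2 by ring, Real.sqrt_sq (by positivity)] at this
    refine this.congr fun n => ?_
    ring_nf
  exact (((coefficient.mul_const w).add (hρ.mul_const z)).sub_const y).sub drift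

lemma eventually_conditional_lt_iff {l : ℝ} (hl : 0 ≤ l)
    (h : Tendsto (fun n : ℕ => (1 - ρ n) * Real.log n) atTop (𝓝 (l ^ 2))) {z w y : ℝ}
    (hne : 2 * l * w ≠ y - z + 2 * l ^ 2) :
    ∀ᶠ n in atTop, (ρ n * normLevel n z + √(1 - ρ n ^ 2) * w < normLevel n y ↔
      2 * l * w ≤ y - z + 2 * l ^ 2) := by
  have threshold := tendsto_conditional_threshold hl h z w y
  rcases lt_or_gt_of_ne hne with hlt | hlt
  · filter_upwards [threshold.eventually_lt_const
      (show 2 * l * w + 1 * z - y - l ^ 2 * 2 < 0 by linarith),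
      eventually_ge_atTop 2] with n hneg hn
    exact iff_of_true ((conditional_lt_iff hn _ _ _ _).2 hneg) hlt.le
  · filter_upwards [threshold.eventually_const_lt
      (show 0 < 2 * l * w + 1 * z - y - l ^ 2 * 2 by linarith),
      eventually_ge_atTop 2] with n hpos hn
    exact iff_of_false (fun hlt' => hpos.not_gt ((conditional_lt_iff hn _ _ _ _).1 hlt')) hlt.not_ge

namespace HuslerReissCondition

variable {lam : ℝ≥0∞}

lemma tendsto_atTop (h : HuslerReissCondition ρ ⊤) :
    Tendsto (fun n : ℕ => (1 - ρ n) * Real.log n) atTop atTop := by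
  rw [HuslerReissCondition, ENNReal.top_pow two_ne_zero] at h
  exact ENNReal.tendsto_ofReal_nhds_top.1 h

lemma tendsto_nhds (h : HuslerReissCondition ρ lam) (hρ : ∀ᶠ n in atTop, |ρ n| ≤ 1)
    (hlam : lam ≠ ⊤) :
    Tendsto (fun n : ℕ => (1 - ρ n) * Real.log n) atTop (𝓝 (lam.toReal ^ 2)) := by
  have := (ENNReal.tendsto_toReal (ENNReal.pow_ne_top hlam (n := 2))).comp h
  rw [ENNReal.toReal_pow] at this
  refine this.congr' ?_
  filter_upwards [hρ] with n hn
  exact ENNReal.toReal_ofReal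
    (mul_nonneg (sub_nonneg.2 (abs_le.1 hn).2) (Real.log_natCast_nonneg n))

lemma tendsto_one_add_atTop (h : HuslerReissCondition ρ lam) (hρ : ∀ᶠ n in atTop, |ρ n| ≤ 1)
    (htop : lam = ⊤ → Tendsto (fun n : ℕ => (1 + ρ n) * Real.log n) atTop atTop) :
    Tendsto (fun n : ℕ => (1 + ρ n) * Real.log n) atTop atTop := by
  by_cases hlam : lam = ⊤
  · exact htop hlam
  refine ((tendsto_log_natCast.const_mul_atTop (zero_lt_two' ℝ)).atTop_add
    (h.tendsto_nhds hρ hlam).neg).congr fun n => ?_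
  ring

lemma ae_eventually_iff (h : HuslerReissCondition ρ lam) (hρ : ∀ᶠ n in atTop, |ρ n| ≤ 1)
    (y : ℝ) :
    ∀ᵐ z : ℝ, ∀ᵐ w ∂(gaussianReal 0 1), ∀ᶠ n in atTop,
      (ρ n * normLevel n z + √(1 - ρ n ^ 2) * w < normLevel n y ↔
        w ∈ conditionalRegion lam y z) := by
  by_cases hlam : lam = ⊤
  · subst hlam
    refine ae_of_all _ fun z => ae_of_all _ fun w => ?_
    filter_upwards [eventually_conditional_lt hρ h.tendsto_atTop z w y] with n hn
    exact iff_of_true hn (Or.inl rfl)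
  simp only [conditionalRegion, hlam, false_or, Set.mem_ofPred_eq]
  have limit := h.tendsto_nhds hρ hlam
  filter_upwards [Measure.ae_ne volume y] with z hz
  by_cases h₀ : lam.toReal = 0
  · refine ae_of_all _ fun w => eventually_conditional_lt_iff ENNReal.toReal_nonneg limit ?_
    rw [h₀]
    intro heq
    exact hz (by linarith)
  · have := nullSingletonClass_gaussianReal (μ := 0) (v := 1) one_ne_zero
    filter_upwards [Measure.ae_ne (gaussianReal 0 1)
      ((y - z + 2 * lam.toReal ^ 2) / (2 * lam.toReal))] with w hw
    refine eventually_conditional_lt_iff ENNReal.toReal_nonneg limit fun heq => hw ?_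
    rw [← heq]
    field_simp

end HuslerReissCondition

lemma measurableSet_conditionalRegion (lam : ℝ≥0∞) (y z : ℝ) :
    MeasurableSet (conditionalRegion lam y z) :=
  (MeasurableSet.const _).union (measurableSet_le (measurable_const_mul _) measurable_const)

end ConditionalExceedance

section BlockExceedance

variable {ρ : ℕ → ℝ} {lam : ℝ≥0∞}

lemma bivLaw_real_swap {r : ℝ} (hr : |r| ≤ 1) {S : Set (ℝ × ℝ)} (hS : MeasurableSet S) :
    (bivLaw r).real (Prod.swap ⁻¹' S) = (bivLaw r).real S := by
  conv_rhs => rw [← bivLaw_map_swap hr, map_measureReal_apply measurable_swap hS]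

lemma bivLaw_real_neg {r : ℝ} (hr : |r| ≤ 1) {S : Set (ℝ × ℝ)} (hS : MeasurableSet S) :
    (bivLaw r).real (-S) = (bivLaw r).real S := by
  conv_rhs => rw [← bivLaw_map_neg hr, map_measureReal_apply measurable_neg hS]
  rfl

section Sandwich

variable {x y : ℝ} {S : ℕ → Set (ℝ × ℝ)} (hS : ∀ n, MeasurableSet (S n))
include hS

lemma tendsto_natCast_mul_bivLaw_fst (ρ : ℕ → ℝ) (hlt : ∀ n, {p | normLevel n x < p.1} ⊆ S n)
    (hle : ∀ n, S n ⊆ {p | normLevel n x ≤ p.1}) :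
    Tendsto (fun n : ℕ => n * (bivLaw (ρ n)).real (S n)) atTop (𝓝 (Real.exp (-x))) := by
  have limit := tendsto_natCast_mul_bivLaw_real (ρ := ρ) hS hle (B := fun _ => Set.univ)
    (fun _ => MeasurableSet.univ) <| by
      filter_upwards [ae_restrict_mem measurableSet_Ioi] with z hz
      refine ae_of_all _ fun w => ?_
      filter_upwards [eventually_ge_atTop 2] with n hn
      exact iff_of_true (hlt n (normLevel_strictMono hn hz)) trivial
  simpa only [probReal_univ, mul_one, integral_exp_neg_Ioi] using limit

lemma tendsto_natCast_mul_bivLaw_snd (hρ : ∀ᶠ n in atTop, |ρ n| ≤ 1)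
    (hlt : ∀ n, {p | normLevel n y < p.2} ⊆ S n) (hle : ∀ n, S n ⊆ {p | normLevel n y ≤ p.2}) :
    Tendsto (fun n : ℕ => n * (bivLaw (ρ n)).real (S n)) atTop (𝓝 (Real.exp (-y))) := by
  refine (tendsto_natCast_mul_bivLaw_fst (S := fun n => Prod.swap ⁻¹' S n)
    (fun n => measurable_swap (hS n)) ρ (fun n p hp => hlt n hp) fun n p hp => hle n hp).congr' ?_
  filter_upwards [hρ] with n hn
  rw [bivLaw_real_swap hn (hS n)]

lemma HuslerReissCondition.tendsto_natCast_mul_bivLaw_inter (h : HuslerReissCondition ρ lam)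
    (hρ : ∀ᶠ n in atTop, |ρ n| ≤ 1)
    (hlt : ∀ n, {p | normLevel n x < p.1 ∧ p.2 < normLevel n y} ⊆ S n)
    (hle : ∀ n, S n ⊆ {p | normLevel n x ≤ p.1 ∧ p.2 < normLevel n y}) :
    Tendsto (fun n : ℕ => n * (bivLaw (ρ n)).real (S n)) atTop (𝓝 (tailLimit lam x y)) := by
  refine tendsto_natCast_mul_bivLaw_real hS (fun n p hp => (hle n hp).1)
    (measurableSet_conditionalRegion lam y) ?_
  filter_upwards [ae_restrict_mem measurableSet_Ioi,
    ae_restrict_of_ae (h.ae_eventually_iff hρ y)] with z hz hae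
  filter_upwards [hae] with w hw
  filter_upwards [hw, eventually_ge_atTop 2] with n hn hn₂
  exact Iff.trans ⟨fun hp => (hle n hp).2, fun hp => hlt n ⟨normLevel_strictMono hn₂ hz, hp⟩⟩ hn

lemma HuslerReissCondition.tendsto_natCast_mul_bivLaw_union (h : HuslerReissCondition ρ lam)
    (hρ : ∀ᶠ n in atTop, |ρ n| ≤ 1)
    (hlt : ∀ n, {p | normLevel n x < p.1 ∨ normLevel n y < p.2} ⊆ S n)
    (hle : ∀ n, S n ⊆ {p | normLevel n x ≤ p.1 ∨ normLevel n y ≤ p.2}) :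
    Tendsto (fun n : ℕ => n * (bivLaw (ρ n)).real (S n)) atTop
      (𝓝 (Real.exp (-y) + tailLimit lam x y)) := by
  have measurable_below (n : ℕ) : MeasurableSet {p : ℝ × ℝ | p.2 < normLevel n y} :=
    measurableSet_lt measurable_snd measurable_const
  have above := tendsto_natCast_mul_bivLaw_snd (y := y)
    (fun n => (hS n).diff (measurable_below n)) hρ
    (fun n p (hp : normLevel n y < p.2) => ⟨hlt n (Or.inr hp), hp.not_gt⟩) fun n p hp => by
      simpa only [Set.mem_ofPred_eq, not_lt] using hp.2
  have below := h.tendsto_natCast_mul_bivLaw_inter (x := x) (y := y)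
    (fun n => (hS n).inter (measurable_below n)) hρ
    (fun n p hp => ⟨hlt n (Or.inl hp.1), hp.2⟩)
    fun n p hp => ⟨(hle n hp.1).resolve_right (not_le.2 hp.2), hp.2⟩
  refine (above.add below).congr fun n => ?_
  rw [← mul_add, add_comm, measureReal_inter_add_sdiff (measurable_below n)]

end Sandwich

lemma measurableSet_opposite (n : ℕ) (x y : ℝ) :
    MeasurableSet {p : ℝ × ℝ | normLevel n x ≤ p.1 ∧ p.2 ≤ -normLevel n y} :=
  (measurableSet_le measurable_const measurable_fst).inter
    (measurableSet_le measurable_snd measurable_const)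

lemma tendsto_natCast_mul_bivLaw_opposite (hρ : ∀ᶠ n in atTop, |ρ n| ≤ 1)
    (h : Tendsto (fun n : ℕ => (1 + ρ n) * Real.log n) atTop atTop) (x y : ℝ) :
    Tendsto (fun n : ℕ => n * (bivLaw (ρ n)).real
      {p | normLevel n x ≤ p.1 ∧ p.2 ≤ -normLevel n y}) atTop (𝓝 0) := by
  have limit := tendsto_natCast_mul_bivLaw_real (ρ := ρ) (x := x) (B := fun _ => ∅)
    (measurableSet_opposite · x y) (fun _ _ hp => hp.1) (fun _ => MeasurableSet.empty) <| by
      refine ae_of_all _ fun z => ae_of_all _ fun w => ?_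
      filter_upwards [eventually_conditional_lt (ρ := fun n => -ρ n) (by simpa only [abs_neg])
        (by simpa only [sub_neg_eq_add]) z (-w) y] with n hn
      refine iff_of_false (fun hp => ?_) (Set.notMem_empty w)
      rw [neg_sq] at hn
      linarith [hp.2]
  simpa only [measureReal_empty, mul_zero, integral_zero] using limit

/-- The event that a component of a pair exceeds its upper level. -/
def upperRegion (n : ℕ) (x₁ x₂ : ℝ) : Set (ℝ × ℝ) :=
  {p | normLevel n x₁ < p.1 ∨ normLevel n x₂ < p.2}

/-- The event that a component of a pair does not exceed its lower level. -/
def lowerRegion (n : ℕ) (y₁ y₂ : ℝ) : Set (ℝ × ℝ) :=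
  {p | p.1 ≤ -normLevel n y₁ ∨ p.2 ≤ -normLevel n y₂}

lemma measurableSet_upperRegion (n : ℕ) (x₁ x₂ : ℝ) : MeasurableSet (upperRegion n x₁ x₂) :=
  (measurableSet_lt measurable_const measurable_fst).union
    (measurableSet_lt measurable_const measurable_snd)

lemma measurableSet_lowerRegion (n : ℕ) (y₁ y₂ : ℝ) : MeasurableSet (lowerRegion n y₁ y₂) :=
  (measurableSet_le measurable_fst measurable_const).union
    (measurableSet_le measurable_snd measurable_const)

lemma prod_Ioc_eq_compl (n : ℕ) (x₁ x₂ y₁ y₂ : ℝ) :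
    Set.Ioc (-normLevel n y₁) (normLevel n x₁) ×ˢ Set.Ioc (-normLevel n y₂) (normLevel n x₂) =
      (upperRegion n x₁ x₂ ∪ lowerRegion n y₁ y₂)ᶜ := by
  ext p
  simp only [upperRegion, lowerRegion, Set.mem_prod, Set.mem_Ioc, Set.mem_compl_iff, Set.mem_union,
    Set.mem_ofPred_eq, not_or, not_lt, not_le]
  tauto

lemma eventually_neg_normLevel_lt (x y : ℝ) : ∀ᶠ n in atTop, -normLevel n y < normLevel n x := by
  have shift_atTop : Tendsto levelShift atTop atTop := by
    refine (tendsto_levelShift_div_log.pos_mul_atTop two_pos tendsto_log_natCast).congr' ?_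
    filter_upwards [eventually_ge_atTop 2] with n hn
    exact div_mul_cancel₀ _ (log_natCast_pos hn).ne'
  filter_upwards [eventually_ge_atTop 2, shift_atTop.eventually_gt_atTop ((-x - y) / 2)]
    with n hn hshift
  rw [← sub_pos, sub_neg_eq_add]
  refine pos_of_mul_pos_right ?_ (sqrt_two_log_pos hn).le
  rw [mul_add, sqrt_mul_normLevel hn, sqrt_mul_normLevel hn]
  linarith

lemma tendsto_natCast_mul_bivLaw_upper_inter_lower (hρ : ∀ᶠ n in atTop, |ρ n| ≤ 1)
    (h : Tendsto (fun n : ℕ => (1 + ρ n) * Real.log n) atTop atTop) (x₁ x₂ y₁ y₂ : ℝ) :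
    Tendsto (fun n : ℕ => n * (bivLaw (ρ n)).real (upperRegion n x₁ x₂ ∩ lowerRegion n y₁ y₂))
      atTop (𝓝 0) := by
  have bound := (tendsto_natCast_mul_bivLaw_opposite hρ h x₁ y₂).add
    (tendsto_natCast_mul_bivLaw_opposite hρ h x₂ y₁)
  rw [add_zero] at bound
  refine squeeze_zero' (Eventually.of_forall fun n => by positivity) ?_ bound
  filter_upwards [hρ, eventually_neg_normLevel_lt x₁ y₁, eventually_neg_normLevel_lt x₂ y₂]
    with n hn h₁ h₂
  rw [← mul_add, ← bivLaw_real_swap hn (measurableSet_opposite n x₂ y₁)]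
  refine mul_le_mul_of_nonneg_left ((measureReal_mono ?_).trans (measureReal_union_le _ _))
    n.cast_nonneg
  rintro p ⟨hp | hp, hp' | hp'⟩
  · exact absurd h₁ (hp.le.trans hp').not_gt
  · exact Or.inl ⟨hp.le, hp'⟩
  · exact Or.inr ⟨hp.le, hp'⟩
  · exact absurd h₂ (hp.le.trans hp').not_gt

namespace HuslerReissCondition

lemma tendsto_natCast_mul_bivLaw_upperRegion (h : HuslerReissCondition ρ lam)
    (hρ : ∀ᶠ n in atTop, |ρ n| ≤ 1) (x₁ x₂ : ℝ) :
    Tendsto (fun n : ℕ => n * (bivLaw (ρ n)).real (upperRegion n x₁ x₂)) atTop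
      (𝓝 (Real.exp (-x₂) + tailLimit lam x₁ x₂)) :=
  h.tendsto_natCast_mul_bivLaw_union (measurableSet_upperRegion · x₁ x₂) hρ
    (fun _ => Set.Subset.rfl) fun _ _ => Or.imp le_of_lt le_of_lt

lemma tendsto_natCast_mul_bivLaw_lowerRegion (h : HuslerReissCondition ρ lam)
    (hρ : ∀ᶠ n in atTop, |ρ n| ≤ 1) (y₁ y₂ : ℝ) :
    Tendsto (fun n : ℕ => n * (bivLaw (ρ n)).real (lowerRegion n y₁ y₂)) atTop
      (𝓝 (Real.exp (-y₂) + tailLimit lam y₁ y₂)) := by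
  refine (h.tendsto_natCast_mul_bivLaw_union (S := fun n => -lowerRegion n y₁ y₂)
    (fun n => (measurableSet_lowerRegion n y₁ y₂).neg) hρ
    (fun n p => Or.imp (fun hp => neg_le_neg (le_of_lt hp)) fun hp => neg_le_neg (le_of_lt hp))
    fun n p => Or.imp neg_le_neg_iff.1 neg_le_neg_iff.1).congr' ?_
  filter_upwards [hρ] with n hn
  rw [bivLaw_real_neg hn (measurableSet_lowerRegion n y₁ y₂)]

/-- Since the upper and the lower region contribute separately to the exponent, the limit is a
product. -/
lemma tendsto_bivLaw_prod_Ioc_pow (h : HuslerReissCondition ρ lam)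
    (hρ : ∀ᶠ n in atTop, |ρ n| ≤ 1)
    (hadd : Tendsto (fun n : ℕ => (1 + ρ n) * Real.log n) atTop atTop) (x₁ x₂ y₁ y₂ : ℝ) :
    Tendsto (fun n : ℕ => (bivLaw (ρ n)).real
      (Set.Ioc (-normLevel n y₁) (normLevel n x₁) ×ˢ
        Set.Ioc (-normLevel n y₂) (normLevel n x₂)) ^ n) atTop
      (𝓝 (huslerReissCDF lam x₁ x₂ * huslerReissCDF lam y₁ y₂)) := by
  have union : Tendsto (fun n : ℕ => n *
      (bivLaw (ρ n)).real (upperRegion n x₁ x₂ ∪ lowerRegion n y₁ y₂)) atTop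
      (𝓝 (Real.exp (-x₂) + tailLimit lam x₁ x₂ + (Real.exp (-y₂) + tailLimit lam y₁ y₂) - 0)) := by
    refine (((h.tendsto_natCast_mul_bivLaw_upperRegion hρ x₁ x₂).add
      (h.tendsto_natCast_mul_bivLaw_lowerRegion hρ y₁ y₂)).sub
      (tendsto_natCast_mul_bivLaw_upper_inter_lower hρ hadd x₁ x₂ y₁ y₂)).congr fun n => ?_
    linear_combination -(n : ℝ) * measureReal_union_add_inter (μ := bivLaw (ρ n))
      (s := upperRegion n x₁ x₂) (measurableSet_lowerRegion n y₁ y₂)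
  have limit := Real.tendsto_one_add_pow_exp_of_tendsto (g := fun n =>
    -(bivLaw (ρ n)).real (upperRegion n x₁ x₂ ∪ lowerRegion n y₁ y₂))
    (union.neg.congr fun n => (mul_neg _ _).symm)
  rw [sub_zero, neg_add, Real.exp_add, ← huslerReissCDF_eq_exp, ← huslerReissCDF_eq_exp] at limit
  refine limit.congr fun n => ?_
  rw [prod_Ioc_eq_compl, probReal_compl_eq_one_sub
    ((measurableSet_upperRegion n x₁ x₂).union (measurableSet_lowerRegion n y₁ y₂)),
    sub_eq_add_neg]

end HuslerReissCondition

end BlockExceedance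

section BermanSum

lemma tendsto_normLevel_sq_div_log (z : ℝ) :
    Tendsto (fun n : ℕ => normLevel n z ^ 2 / Real.log n) atTop (𝓝 2) := by
  have := ((((tendsto_const_nhds (x := z)).div_atTop tendsto_log_natCast).add
    tendsto_levelShift_div_log).pow 2).div_const 2
  rw [zero_add, sq, mul_div_cancel_right₀ _ two_ne_zero] at this
  refine this.congr' ?_
  filter_upwards [eventually_ge_atTop 2] with n hn
  have := log_natCast_pos hn
  rw [normLevel_sq hn]
  field_simp

lemma tendsto_early_terms {σ α : ℝ} (hσ : 0 ≤ σ) (hα : α < (1 - σ) / (1 + σ)) (z : ℝ) :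
    Tendsto (fun n : ℕ => n * (⌊(n : ℝ) ^ α⌋₊ * Real.exp (-normLevel n z ^ 2 / (1 + σ)))) atTop
      (𝓝 0) := by
  have rate := ((tendsto_normLevel_sq_div_log z).div_const (1 + σ)).const_sub (1 + α)
  have rate_neg : 1 + α - 2 / (1 + σ) < 0 := by
    rw [lt_div_iff₀ (by positivity)] at hα
    rw [sub_neg, lt_div_iff₀ (by positivity)]
    linarith
  have bound := Real.tendsto_exp_atBot.comp (tendsto_log_natCast.atTop_mul_neg rate_neg rate)
  refine squeeze_zero' (Eventually.of_forall fun n => by positivity) ?_ bound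
  filter_upwards [eventually_ge_atTop 2] with n hn
  have log_pos := log_natCast_pos hn
  have cast_pos : (0 : ℝ) < n := by positivity
  calc (n : ℝ) * (⌊(n : ℝ) ^ α⌋₊ * Real.exp (-normLevel n z ^ 2 / (1 + σ)))
      ≤ n * ((n : ℝ) ^ α * Real.exp (-normLevel n z ^ 2 / (1 + σ))) := by
        gcongr
        exact Nat.floor_le (by positivity)
    _ = Real.exp (Real.log n) * (Real.exp (Real.log n * α) *
          Real.exp (-normLevel n z ^ 2 / (1 + σ))) := by
        rw [Real.exp_log cast_pos, ← Real.rpow_def_of_pos cast_pos]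
    _ = Real.exp (Real.log n * (1 + α - normLevel n z ^ 2 / Real.log n / (1 + σ))) := by
        rw [← Real.exp_add, ← Real.exp_add]
        congr 1
        field_simp
        ring

lemma natCast_sq_mul_exp_le {n : ℕ} (hn : 2 ≤ n) (z : ℝ) :
    (n : ℝ) ^ 2 * Real.exp (-normLevel n z ^ 2) ≤
      4 * Real.pi * Real.exp (-(2 * z)) * Real.log n := by
  have log_pos := log_natCast_pos hn
  have sq_le : 2 * (z + levelShift n) - 2 * Real.log n ≤ normLevel n z ^ 2 := by
    rw [normLevel_sq hn, le_div_iff₀ (by positivity)]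
    linarith [sq_nonneg (z + levelShift n - 2 * Real.log n)]
  calc (n : ℝ) ^ 2 * Real.exp (-normLevel n z ^ 2)
      = Real.exp (2 * Real.log n - normLevel n z ^ 2) := by
        rw [← Real.rpow_natCast, Real.rpow_def_of_pos (by positivity), ← Real.exp_add,
          Nat.cast_ofNat, mul_comm, sub_eq_add_neg]
    _ ≤ Real.exp (-(2 * z) + Real.log (4 * Real.pi * Real.log n)) := by
        gcongr
        rw [levelShift] at sq_le
        linarith
    _ = 4 * Real.pi * Real.exp (-(2 * z)) * Real.log n := by
        rw [Real.exp_add, Real.exp_log (by positivity)]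
        ring

lemma tendsto_late_terms {δ : ℕ → ℝ} (hδ : ∀ n, 0 ≤ δ n)
    (h : Tendsto (fun n : ℕ => δ n * Real.log n) atTop (𝓝 0)) (z : ℝ) :
    Tendsto (fun n : ℕ => (n : ℝ) ^ 2 * (δ n * Real.exp (-normLevel n z ^ 2 / (1 + δ n)))) atTop
      (𝓝 0) := by
  have correction : Tendsto (fun n : ℕ => Real.exp
      (δ n * Real.log n * (normLevel n z ^ 2 / Real.log n))) atTop (𝓝 (Real.exp (0 * 2))) :=
    (Real.continuous_exp.tendsto _).comp (h.mul (tendsto_normLevel_sq_div_log z))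
  have bound := (h.const_mul (4 * Real.pi * Real.exp (-(2 * z)))).mul correction
  rw [mul_zero, zero_mul] at bound
  refine squeeze_zero' (Eventually.of_forall fun n => ?_) ?_ bound
  · have := hδ n
    positivity
  filter_upwards [eventually_ge_atTop 2] with n hn
  have log_pos := log_natCast_pos hn
  have nonneg := hδ n
  have exponent : -normLevel n z ^ 2 / (1 + δ n) ≤
      -normLevel n z ^ 2 + δ n * Real.log n * (normLevel n z ^ 2 / Real.log n) := by
    rw [div_le_iff₀ (by positivity), mul_assoc (δ n), mul_div_cancel₀ _ log_pos.ne']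
    linarith [mul_nonneg (sq_nonneg (δ n)) (sq_nonneg (normLevel n z))]
  calc (n : ℝ) ^ 2 * (δ n * Real.exp (-normLevel n z ^ 2 / (1 + δ n)))
      ≤ (n : ℝ) ^ 2 * (δ n * (Real.exp (-normLevel n z ^ 2) *
          Real.exp (δ n * Real.log n * (normLevel n z ^ 2 / Real.log n)))) := by
        rw [← Real.exp_add]
        gcongr
    _ = δ n * ((n : ℝ) ^ 2 * Real.exp (-normLevel n z ^ 2)) *
          Real.exp (δ n * Real.log n * (normLevel n z ^ 2 / Real.log n)) := by ring
    _ ≤ δ n * (4 * Real.pi * Real.exp (-(2 * z)) * Real.log n) *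
          Real.exp (δ n * Real.log n * (normLevel n z ^ 2 / Real.log n)) := by
        gcongr ?_ * _
        exact mul_le_mul_of_nonneg_left (natCast_sq_mul_exp_le hn z) nonneg
    _ = 4 * Real.pi * Real.exp (-(2 * z)) * (δ n * Real.log n) *
          Real.exp (δ n * Real.log n * (normLevel n z ^ 2 / Real.log n)) := by ring

/-- The distance `|k - l|` between two positions in a row. -/
def lag {n : ℕ} (k l : Fin n) : ℕ := (((k : ℕ) : ℤ) - ((l : ℕ) : ℤ)).natAbs

lemma lag_lt {n : ℕ} (k l : Fin n) : lag k l < n := by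
  rw [lag]
  omega

lemma lag_pos {n : ℕ} {k l : Fin n} (hkl : k ≠ l) : 1 ≤ lag k l := by
  have := Fin.val_ne_of_ne hkl
  rw [lag]
  omega

lemma card_filter_lag_lt_le {n : ℕ} (ι : Type*) [Fintype ι] (k : Fin n) (m : ℕ) :
    (Finset.univ.filter fun q : Fin n × ι => lag k q.1 < m).card ≤ 2 * m * Fintype.card ι := by
  calc (Finset.univ.filter fun q : Fin n × ι => lag k q.1 < m).card
      ≤ (Finset.Ioo ((k : ℕ) - m : ℤ) ((k : ℕ) + m) ×ˢ (Finset.univ : Finset ι)).card := by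
        refine Finset.card_le_card_of_injOn (fun q => (((q.1 : ℕ) : ℤ), q.2)) ?_ ?_
        · intro q hq
          have near := (Finset.mem_filter.1 (Finset.mem_coe.1 hq)).2
          rw [lag] at near
          simp only [Finset.coe_product, Set.mem_prod, Finset.mem_coe, Finset.mem_Ioo,
            Finset.mem_univ, and_true]
          omega
        · rintro ⟨a, i⟩ - ⟨b, j⟩ - hab
          simp only [Prod.mk.injEq, Nat.cast_inj] at hab
          exact Prod.ext (Fin.ext hab.1) hab.2
    _ ≤ 2 * m * Fintype.card ι := by
        rw [Finset.card_product, Int.card_Ioo, Finset.card_univ]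
        gcongr
        omega

lemma mul_exp_neg_sq_div_mono {w a b : ℝ} (ha : 0 ≤ a) (hab : a ≤ b) :
    a * Real.exp (-w ^ 2 / (1 + a)) ≤ b * Real.exp (-w ^ 2 / (1 + b)) := by
  have hb := ha.trans hab
  rw [neg_div, neg_div]
  gcongr

variable {n : ℕ} {ρ : Fin 2 → Fin 2 → ℕ → ℕ → ℝ} {α σ : ℝ}

lemma abs_le_maxLateCorr {k : ℕ} (i j : Fin 2) (hk : ⌊(n : ℝ) ^ α⌋₊ ≤ k) (hkn : k < n) :
    |ρ i j k n| ≤ maxLateCorr ρ α n := by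
  rw [← Real.norm_eq_abs, ← coe_nnnorm, NNReal.coe_le_coe]
  exact (Finset.le_sup (f := fun p : Fin 2 × Fin 2 => ‖ρ p.1 p.2 k n‖₊)
    (Finset.mem_univ (i, j))).trans
      (Finset.le_sup (f := fun k => Finset.univ.sup fun p : Fin 2 × Fin 2 => ‖ρ p.1 p.2 k n‖₊)
        (Finset.mem_Ico.2 ⟨hk, hkn⟩))

/-- The correlation of two entries of row `n`, set to zero for entries of the same pair. -/
noncomputable def lagCorr (ρ : Fin 2 → Fin 2 → ℕ → ℕ → ℝ) {n : ℕ} (p q : Fin n × Fin 2) : ℝ :=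
  if p.1 = q.1 then 0 else ρ p.2 q.2 (lag p.1 q.1) n

lemma abs_lagCorr_mul_exp_le (hσ : σ ≤ 1) (w : ℝ)
    (hρ : ∀ k i j, 1 ≤ k → k < n → |ρ i j k n| ≤ σ) (p q : Fin n × Fin 2) :
    |lagCorr ρ p q| * Real.exp (-w ^ 2 / (1 + |lagCorr ρ p q|)) ≤
      (if lag p.1 q.1 < ⌊(n : ℝ) ^ α⌋₊ then Real.exp (-w ^ 2 / (1 + σ)) else 0) +
        maxLateCorr ρ α n * Real.exp (-w ^ 2 / (1 + maxLateCorr ρ α n)) := by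
  rw [lagCorr]
  split_ifs with same early early
  iterate 2
    rw [abs_zero, zero_mul]
    positivity
  · calc |ρ p.2 q.2 (lag p.1 q.1) n| *
          Real.exp (-w ^ 2 / (1 + |ρ p.2 q.2 (lag p.1 q.1) n|))
        ≤ σ * Real.exp (-w ^ 2 / (1 + σ)) :=
          mul_exp_neg_sq_div_mono (abs_nonneg _) (hρ _ _ _ (lag_pos same) (lag_lt _ _))
      _ ≤ Real.exp (-w ^ 2 / (1 + σ)) := mul_le_of_le_one_left (Real.exp_pos _).le hσ
      _ ≤ _ := le_add_of_nonneg_right (by positivity)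
  · rw [zero_add]
    exact mul_exp_neg_sq_div_mono (abs_nonneg _)
      (abs_le_maxLateCorr _ _ (not_lt.1 early) (lag_lt _ _))

lemma sum_le_of_le_early_add_late {m : ℕ} {e d : ℝ} (he : 0 ≤ e)
    {f : Fin n × Fin 2 → Fin n × Fin 2 → ℝ}
    (hf : ∀ p q, f p q ≤ (if lag p.1 q.1 < m then e else 0) + d) :
    ∑ p, ∑ q, f p q ≤ 8 * (n * (m * e)) + 4 * (n ^ 2 * d) := by
  have row (p : Fin n × Fin 2) : ∑ q, f p q ≤ 4 * m * e + 2 * n * d := by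
    have count : ((Finset.univ.filter fun q : Fin n × Fin 2 => lag p.1 q.1 < m).card : ℝ) ≤
        4 * m := by
      have := card_filter_lag_lt_le (Fin 2) p.1 m
      rw [Fintype.card_fin] at this
      exact_mod_cast this.trans_eq (by ring)
    calc ∑ q, f p q ≤ ∑ q : Fin n × Fin 2, ((if lag p.1 q.1 < m then e else 0) + d) :=
          Finset.sum_le_sum fun q _ => hf p q
      _ = (Finset.univ.filter fun q : Fin n × Fin 2 => lag p.1 q.1 < m).card * e +
            2 * n * d := by
          rw [Finset.sum_add_distrib, ← Finset.sum_filter, Finset.sum_const, Finset.sum_const,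
            Finset.card_univ, Fintype.card_prod, Fintype.card_fin, Fintype.card_fin,
            nsmul_eq_mul, nsmul_eq_mul, Nat.cast_mul, Nat.cast_ofNat, mul_comm (n : ℝ)]
      _ ≤ 4 * m * e + 2 * n * d := by gcongr
  calc ∑ p, ∑ q, f p q ≤ ∑ _p : Fin n × Fin 2, (4 * m * e + 2 * n * d) :=
        Finset.sum_le_sum fun p _ => row p
    _ = 8 * (n * (m * e)) + 4 * (n ^ 2 * d) := by
        rw [Finset.sum_const, Finset.card_univ, Fintype.card_prod, Fintype.card_fin,
          Fintype.card_fin, nsmul_eq_mul, Nat.cast_mul, Nat.cast_ofNat]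
        ring

lemma sum_abs_lagCorr_mul_exp_le (hσ : σ ≤ 1) (w : ℝ)
    (hρ : ∀ k i j, 1 ≤ k → k < n → |ρ i j k n| ≤ σ) :
    ∑ p : Fin n × Fin 2, ∑ q : Fin n × Fin 2,
        |lagCorr ρ p q| * Real.exp (-w ^ 2 / (1 + |lagCorr ρ p q|)) ≤
      8 * (n * (⌊(n : ℝ) ^ α⌋₊ * Real.exp (-w ^ 2 / (1 + σ)))) +
        4 * (n ^ 2 * (maxLateCorr ρ α n * Real.exp (-w ^ 2 / (1 + maxLateCorr ρ α n)))) :=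
  sum_le_of_le_early_add_late (Real.exp_pos _).le (abs_lagCorr_mul_exp_le hσ w hρ)

end BermanSum

section IndependentPairs

/-- The coordinate projections of the plane, indexed like the components of the array. -/
noncomputable def pairCoord : Fin 2 → ℝ × ℝ →L[ℝ] ℝ :=
  ![ContinuousLinearMap.fst ℝ ℝ ℝ, ContinuousLinearMap.snd ℝ ℝ ℝ]

/-- The law of `n` independent pairs of standard Gaussian variables with correlation `r`. -/
noncomputable def iidPairLaw (r : ℝ) (n : ℕ) : Measure (Fin n → ℝ × ℝ) :=
  Measure.pi fun _ => bivLaw r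

instance (r : ℝ) (n : ℕ) : IsProbabilityMeasure (iidPairLaw r n) := by
  unfold iidPairLaw
  infer_instance

lemma measurePreserving_eval_iidPairLaw (r : ℝ) {n : ℕ} (k : Fin n) :
    MeasurePreserving (Function.eval k) (iidPairLaw r n) (bivLaw r) :=
  measurePreserving_eval (fun _ => bivLaw r) k

lemma iIndepFun_eval_iidPairLaw (r : ℝ) (n : ℕ) :
    iIndepFun (fun (k : Fin n) (ω : Fin n → ℝ × ℝ) => ω k) (iidPairLaw r n) :=
  iIndepFun_pi (X := fun _ => id) fun _ => aemeasurable_id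

lemma hasGaussianLaw_pairCoord (r : ℝ) (n : ℕ) :
    HasGaussianLaw (fun (ω : Fin n → ℝ × ℝ) (p : Fin n × Fin 2) => pairCoord p.2 (ω p.1))
      (iidPairLaw r n) := by
  have joint : HasGaussianLaw (fun (ω : Fin n → ℝ × ℝ) k => ω k) (iidPairLaw r n) :=
    (iIndepFun_eval_iidPairLaw r n).hasGaussianLaw fun k =>
      ⟨by
        change IsGaussian ((iidPairLaw r n).map (Function.eval k))
        rw [(measurePreserving_eval_iidPairLaw r k).map_eq]
        infer_instance⟩
  exact joint.map (ContinuousLinearMap.pi fun p : Fin n × Fin 2 =>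
    (pairCoord p.2).comp (ContinuousLinearMap.proj p.1))

lemma integral_pairCoord (r : ℝ) {n : ℕ} (k : Fin n) (i : Fin 2) :
    ∫ ω, pairCoord i (ω k) ∂(iidPairLaw r n) = 0 := by
  have transfer : ∫ ω, pairCoord i (ω k) ∂(iidPairLaw r n) = ∫ p, pairCoord i p ∂(bivLaw r) := by
    rw [← (measurePreserving_eval_iidPairLaw r k).map_eq,
      integral_map (measurable_pi_apply k).aemeasurable
        (pairCoord i).continuous.aestronglyMeasurable]
  rw [transfer]
  fin_cases i
  · simpa [pairCoord] using integral_linear_bivLaw r 1 0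
  · simpa [pairCoord] using integral_linear_bivLaw r 0 1

variable {r : ℝ} {n : ℕ}

lemma covariance_pairCoord_same (hr : |r| ≤ 1) (k : Fin n) (i j : Fin 2) :
    cov[fun ω => pairCoord i (ω k), fun ω => pairCoord j (ω k); iidPairLaw r n] =
      if i = j then 1 else r := by
  have transfer : cov[fun ω => pairCoord i (ω k), fun ω => pairCoord j (ω k); iidPairLaw r n] =
      cov[pairCoord i, pairCoord j; bivLaw r] := by
    rw [← (measurePreserving_eval_iidPairLaw r k).map_eq,
      covariance_map (pairCoord i).continuous.aestronglyMeasurable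
        (pairCoord j).continuous.aestronglyMeasurable (measurable_pi_apply k).aemeasurable]
    rfl
  rw [transfer]
  fin_cases i <;> fin_cases j
  · simpa [pairCoord] using covariance_linear_bivLaw hr 1 0 1 0
  · simpa [pairCoord] using covariance_linear_bivLaw hr 1 0 0 1
  · simpa [pairCoord] using covariance_linear_bivLaw hr 0 1 1 0
  · simpa [pairCoord] using covariance_linear_bivLaw hr 0 1 0 1

lemma variance_pairCoord (hr : |r| ≤ 1) (k : Fin n) (i : Fin 2) :
    Var[fun ω => pairCoord i (ω k); iidPairLaw r n] = 1 := by
  rw [← covariance_self ((hasGaussianLaw_pairCoord r n).eval (k, i)).aemeasurable,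
    covariance_pairCoord_same hr, if_pos rfl]

lemma covariance_pairCoord_of_ne (r : ℝ) {k l : Fin n} (hkl : k ≠ l) (i j : Fin 2) :
    cov[fun ω => pairCoord i (ω k), fun ω => pairCoord j (ω l); iidPairLaw r n] = 0 :=
  (((iIndepFun_eval_iidPairLaw r n).indepFun hkl).comp (pairCoord i).continuous.measurable
    (pairCoord j).continuous.measurable).covariance_eq_zero
    ((hasGaussianLaw_pairCoord r n).eval (k, i)).memLp_two
    ((hasGaussianLaw_pairCoord r n).eval (l, j)).memLp_two

lemma iidPairLaw_real_pairCoord (r : ℝ) (n : ℕ) (s : Fin 2 → Set ℝ) :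
    (iidPairLaw r n).real {ω | ∀ p : Fin n × Fin 2, pairCoord p.2 (ω p.1) ∈ s p.2} =
      (bivLaw r).real (s 0 ×ˢ s 1) ^ n := by
  have event : {ω : Fin n → ℝ × ℝ | ∀ p : Fin n × Fin 2, pairCoord p.2 (ω p.1) ∈ s p.2} =
      Set.univ.pi fun _ => s 0 ×ˢ s 1 := by
    ext ω
    simp [pairCoord, Prod.forall, Fin.forall_fin_two]
  rw [event, measureReal_def, iidPairLaw, Measure.pi_pi, Finset.prod_const, Finset.card_univ,
    Fintype.card_fin, ENNReal.toReal_pow, measureReal_def]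

end IndependentPairs

section Uniformity

variable {ι κ : Type*} {l : Filter κ}

lemma tendstoLocallyUniformly_of_monotone [Finite ι] {F : κ → (ι → ℝ) → ℝ} {G : (ι → ℝ) → ℝ}
    (hF : ∀ᶠ n in l, Monotone (F n)) (hG : Continuous G)
    (h : ∀ z, Tendsto (fun n => F n z) l (𝓝 (G z))) : TendstoLocallyUniformly F G l := by
  have := Fintype.ofFinite ι
  refine Metric.tendstoLocallyUniformly_iff.2 fun ε hε z => ?_
  obtain ⟨δ, hδ, ball_subset⟩ := Metric.nhds_basis_closedBall.mem_iff.1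
    (Metric.continuousAt_iff'.1 hG.continuousAt (ε / 3) (by positivity))
  refine ⟨Metric.closedBall z δ, Metric.closedBall_mem_nhds z hδ, ?_⟩
  have close {w : ι → ℝ} (hw : ∀ i, |w i - z i| ≤ δ) : |G w - G z| < ε / 3 :=
    ball_subset (Metric.mem_closedBall.2 ((dist_pi_le_iff hδ.le).2 hw))
  have upper := close (w := fun i => z i + δ) fun i => by rw [add_sub_cancel_left, abs_of_pos hδ]
  have lower := close (w := fun i => z i - δ) fun i => by
    rw [sub_sub_cancel_left, abs_neg, abs_of_pos hδ]
  have third_pos : 0 < ε / 3 := by positivity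
  filter_upwards [hF,
    (h fun i => z i + δ).eventually_lt_const (lt_add_of_pos_right _ third_pos),
    (h fun i => z i - δ).eventually_const_lt (sub_lt_self _ third_pos)]
    with n mono F_upper F_lower w hw
  have near (i : ι) : |w i - z i| ≤ δ := (dist_le_pi_dist w z i).trans hw
  have le_upper : F n w ≤ F n fun i => z i + δ :=
    mono fun i => by linarith [(abs_le.1 (near i)).2]
  have lower_le : (F n fun i => z i - δ) ≤ F n w :=
    mono fun i => by linarith [(abs_le.1 (near i)).1]
  have limit_near := close near
  rw [Real.dist_eq, abs_lt]
  rw [abs_lt] at upper lower limit_near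
  constructor <;> linarith [upper.1, upper.2, lower.1, lower.2, limit_near.1, limit_near.2]

/-- The properties of the distribution function of a random vector on which Pólya's theorem rests.
One-sided continuity is not among them, so that strict and weak inequalities may be mixed. -/
structure IsDistributionLike (F : (ι → ℝ) → ℝ) : Prop where
  nonneg : ∀ z, 0 ≤ F z
  monotone : Monotone F
  sub_inf_le : ∀ z w, F z - F (z ⊓ w) ≤ 1 - F w

namespace IsDistributionLike

lemma of_tendsto [l.NeBot] {F : κ → (ι → ℝ) → ℝ} {G : (ι → ℝ) → ℝ}
    (hF : ∀ᶠ n in l, IsDistributionLike (F n)) (h : ∀ z, Tendsto (fun n => F n z) l (𝓝 (G z))) :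
    IsDistributionLike G where
  nonneg z := ge_of_tendsto (h z) (hF.mono fun _ hn => hn.nonneg z)
  monotone z w hzw :=
    le_of_tendsto_of_tendsto (h z) (h w) (hF.mono fun _ hn => hn.monotone hzw)
  sub_inf_le z w := le_of_tendsto_of_tendsto ((h z).sub (h (z ⊓ w))) ((h w).const_sub 1)
    (hF.mono fun _ hn => hn.sub_inf_le z w)

/-- Replacing `z` by `z ⊓ K` costs at most `ε`; if a coordinate of `z` is then still below `-K`,
both functions are at most `ε`. -/
lemma abs_sub_le_of_box [DecidableEq ι] {F G : (ι → ℝ) → ℝ} (hF : IsDistributionLike F)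
    (hG : IsDistributionLike G) {K ε : ℝ} (F_top : 1 - ε ≤ F fun _ => K)
    (G_top : 1 - ε ≤ G fun _ => K)
    (F_bot : ∀ i, F (Function.update (fun _ => K) i (-K)) ≤ ε)
    (G_bot : ∀ i, G (Function.update (fun _ => K) i (-K)) ≤ ε)
    (box : ∀ z ∈ Set.Icc (fun _ => -K) fun _ => K, |F z - G z| ≤ ε) (z : ι → ℝ) :
    |F z - G z| ≤ 2 * ε := by
  set c : ι → ℝ := fun _ => K
  have capped : |F (z ⊓ c) - G (z ⊓ c)| ≤ ε := by
    by_cases inside : ∀ i, -K ≤ (z ⊓ c) i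
    · exact box _ ⟨inside, inf_le_right⟩
    obtain ⟨i, hi⟩ := not_forall.1 inside
    have le_update : z ⊓ c ≤ Function.update c i (-K) :=
      le_update_iff.2 ⟨(not_le.1 hi).le, fun j _ => inf_le_right⟩
    rw [abs_le]
    constructor
    · linarith [hF.nonneg (z ⊓ c), hG.monotone le_update, G_bot i]
    · linarith [hG.nonneg (z ⊓ c), hF.monotone le_update, F_bot i]
  have F_cap := hF.monotone (inf_le_left : z ⊓ c ≤ z)
  have G_cap := hG.monotone (inf_le_left : z ⊓ c ≤ z)
  rw [abs_le] at capped ⊢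
  constructor
  · linarith [hG.sub_inf_le z c]
  · linarith [hF.sub_inf_le z c]

end IsDistributionLike

/-- Pólya's theorem. -/
lemma tendstoUniformly_of_isDistributionLike [Finite ι] [l.NeBot] {F : κ → (ι → ℝ) → ℝ}
    {G : (ι → ℝ) → ℝ} (hF : ∀ᶠ n in l, IsDistributionLike (F n)) (hG : Continuous G)
    (h : ∀ z, Tendsto (fun n => F n z) l (𝓝 (G z)))
    (htop : Tendsto (fun K : ℝ => G fun _ => K) atTop (𝓝 1)) {g : ℝ → ℝ}
    (hg : Tendsto g atBot (𝓝 0)) (hGg : ∀ z i, G z ≤ g (z i)) : TendstoUniformly F G l := by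
  classical
  refine Metric.tendstoUniformly_iff.2 fun ε hε => ?_
  obtain ⟨K, G_top, g_bot⟩ := ((htop.eventually_const_lt (show 1 - ε / 4 < 1 by linarith)).and
    ((hg.comp tendsto_neg_atTop_atBot).eventually_lt_const
      (show 0 < ε / 4 by positivity))).exists
  have G_bot (i : ι) : G (Function.update (fun _ => K) i (-K)) < ε / 4 :=
    (hGg _ i).trans_lt (by rwa [Function.update_self])
  have box : TendstoUniformlyOn F G l (Set.Icc (fun _ => -K) fun _ => K) :=
    (tendstoLocallyUniformlyOn_iff_tendstoUniformlyOn_of_compact isCompact_Icc).1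
      (tendstoLocallyUniformly_of_monotone (hF.mono fun _ hn => hn.monotone) hG
        h).tendstoLocallyUniformlyOn
  filter_upwards [hF, Metric.tendstoUniformlyOn_iff.1 box (ε / 4) (by positivity),
    (h fun _ => K).eventually_const_lt G_top,
    eventually_all.2 fun i => (h _).eventually_lt_const (G_bot i)] with n hn box_n F_top F_bot z
  rw [dist_comm]
  refine (hn.abs_sub_le_of_box (.of_tendsto hF h) F_top.le G_top.le (fun i => (F_bot i).le)
    (fun i => (G_bot i).le) (fun z hz => ?_) z).trans_lt (by linarith : 2 * (ε / 4) < ε)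
  rw [← Real.dist_eq, dist_comm]
  exact (box_n z hz).le

lemma tendsto_iSup_abs_sub_of_tendstoUniformly {α : Type*} {F : κ → α → ℝ} {G : α → ℝ}
    (h : TendstoUniformly F G l) : Tendsto (fun n => ⨆ z, |F n z - G z|) l (𝓝 0) := by
  refine Metric.tendsto_nhds.2 fun ε hε => ?_
  filter_upwards [Metric.tendstoUniformly_iff.1 h (ε / 2) (half_pos hε)] with n hn
  rw [Real.dist_eq, sub_zero, abs_of_nonneg (Real.iSup_nonneg fun z => abs_nonneg _)]
  refine (Real.iSup_le (fun z => ?_) (half_pos hε).le).trans_lt (half_lt_self hε)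
  rw [← Real.dist_eq, dist_comm]
  exact (hn z).le

end Uniformity

section LimitLaw

lemma tailLimit_nonneg (lam : ℝ≥0∞) (x y : ℝ) : 0 ≤ tailLimit lam x y :=
  integral_nonneg fun _ => mul_nonneg (Real.exp_pos _).le measureReal_nonneg

lemma tailLimit_le (lam : ℝ≥0∞) (x y : ℝ) : tailLimit lam x y ≤ Real.exp (-x) := by
  rw [← integral_exp_neg_Ioi]
  exact integral_mono_of_nonneg
    (ae_of_all _ fun _ => mul_nonneg (Real.exp_pos _).le measureReal_nonneg)
    (integrableOn_exp_neg_Ioi x)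
    (ae_of_all _ fun _ => mul_le_of_le_one_right (Real.exp_pos _).le measureReal_le_one)

lemma huslerReissCDF_comm (lam : ℝ≥0∞) (x y : ℝ) :
    huslerReissCDF lam x y = huslerReissCDF lam y x := by
  unfold huslerReissCDF
  split_ifs
  · exact min_comm _ _
  · exact mul_comm _ _
  · congr 1
    ring

lemma huslerReissCDF_nonneg (lam : ℝ≥0∞) (x y : ℝ) : 0 ≤ huslerReissCDF lam x y := by
  rw [huslerReissCDF_eq_exp]
  exact (Real.exp_pos _).le

lemma huslerReissCDF_le_right (lam : ℝ≥0∞) (x y : ℝ) : huslerReissCDF lam x y ≤ gumbelCDF y := by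
  rw [huslerReissCDF_eq_exp, gumbelCDF, Real.exp_le_exp]
  linarith [tailLimit_nonneg lam x y]

lemma huslerReissCDF_le_left (lam : ℝ≥0∞) (x y : ℝ) : huslerReissCDF lam x y ≤ gumbelCDF x := by
  rw [huslerReissCDF_comm]
  exact huslerReissCDF_le_right lam y x

lemma gumbelCDF_le_one (x : ℝ) : gumbelCDF x ≤ 1 := by
  rw [gumbelCDF, Real.exp_le_one_iff]
  linarith [Real.exp_pos (-x)]

lemma huslerReissCDF_le_one (lam : ℝ≥0∞) (x y : ℝ) : huslerReissCDF lam x y ≤ 1 :=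
  (huslerReissCDF_le_left lam x y).trans (gumbelCDF_le_one x)

lemma continuous_gumbelCDF : Continuous gumbelCDF := by
  unfold gumbelCDF
  fun_prop

lemma continuous_huslerReissCDF (lam : ℝ≥0∞) :
    Continuous fun p : ℝ × ℝ => huslerReissCDF lam p.1 p.2 := by
  have := continuous_gumbelCDF
  have := continuous_stdNormalCDF
  unfold huslerReissCDF
  split_ifs <;> fun_prop

lemma tendsto_gumbelCDF_atBot : Tendsto gumbelCDF atBot (𝓝 0) :=
  Real.tendsto_exp_neg_atTop_nhds_zero.comp
    (Real.tendsto_exp_atTop.comp tendsto_neg_atBot_atTop)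

lemma tendsto_huslerReissCDF_diag_atTop (lam : ℝ≥0∞) :
    Tendsto (fun K : ℝ => huslerReissCDF lam K K) atTop (𝓝 1) := by
  have lower : Tendsto (fun K : ℝ => Real.exp (-(Real.exp (-K) + Real.exp (-K)))) atTop (𝓝 1) := by
    have h := Real.tendsto_exp_neg_atTop_nhds_zero
    have := (Real.continuous_exp.tendsto _).comp (h.add h).neg
    rwa [add_zero, neg_zero, Real.exp_zero] at this
  refine tendsto_of_tendsto_of_tendsto_of_le_of_le lower tendsto_const_nhds (fun K => ?_)
    fun K => huslerReissCDF_le_one lam K K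
  dsimp only
  rw [huslerReissCDF_eq_exp, Real.exp_le_exp]
  linarith [tailLimit_le lam K K]

/-- The limiting joint distribution function of the normalised maxima (left summand) and minima
(right summand). -/
noncomputable def limitCDF (lam : ℝ≥0∞) (z : Fin 2 ⊕ Fin 2 → ℝ) : ℝ :=
  huslerReissCDF lam (z (.inl 0)) (z (.inl 1)) * huslerReissCDF lam (z (.inr 0)) (z (.inr 1))

lemma continuous_limitCDF (lam : ℝ≥0∞) : Continuous (limitCDF lam) := by
  have pair (i j : Fin 2 ⊕ Fin 2) :
      Continuous fun z : Fin 2 ⊕ Fin 2 → ℝ => huslerReissCDF lam (z i) (z j) :=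
    (continuous_huslerReissCDF lam).comp (f := fun z : Fin 2 ⊕ Fin 2 → ℝ => (z i, z j))
      (by fun_prop)
  exact (pair _ _).mul (pair _ _)

lemma tendsto_limitCDF_diag_atTop (lam : ℝ≥0∞) :
    Tendsto (fun K : ℝ => limitCDF lam fun _ => K) atTop (𝓝 1) := by
  have diag := tendsto_huslerReissCDF_diag_atTop lam
  have := diag.mul diag
  rwa [mul_one] at this

lemma limitCDF_le_gumbelCDF (lam : ℝ≥0∞) (z : Fin 2 ⊕ Fin 2 → ℝ) (i : Fin 2 ⊕ Fin 2) :
    limitCDF lam z ≤ gumbelCDF (z i) := by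
  have le_maxima : limitCDF lam z ≤ huslerReissCDF lam (z (.inl 0)) (z (.inl 1)) :=
    mul_le_of_le_one_right (huslerReissCDF_nonneg _ _ _) (huslerReissCDF_le_one _ _ _)
  have le_minima : limitCDF lam z ≤ huslerReissCDF lam (z (.inr 0)) (z (.inr 1)) :=
    mul_le_of_le_one_left (huslerReissCDF_nonneg _ _ _) (huslerReissCDF_le_one _ _ _)
  rcases i with i | i <;> fin_cases i
  · exact le_maxima.trans (huslerReissCDF_le_left _ _ _)
  · exact le_maxima.trans (huslerReissCDF_le_right _ _ _)
  · exact le_minima.trans (huslerReissCDF_le_left _ _ _)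
  · exact le_minima.trans (huslerReissCDF_le_right _ _ _)

end LimitLaw

section Array

variable {Ω : Type*}

/-- The event that all extremes of row `n` lie within the levels given by `z`, where the left and
the right summand of the index type refer to the maxima and to the minima. -/
def extremesEvent (X : (n : ℕ) → Fin n → Fin 2 → Ω → ℝ) (n : ℕ) (z : Fin 2 ⊕ Fin 2 → ℝ) : Set Ω :=
  {ω | ∀ i : Fin 2, -normLevel n (z (.inr i)) < rowMin X n i ω ∧
    rowMin X n i ω ≤ rowMax X n i ω ∧ rowMax X n i ω ≤ normLevel n (z (.inl i))}

variable {X : (n : ℕ) → Fin n → Fin 2 → Ω → ℝ}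

lemma extremesEvent_eq_box {n : ℕ} (hn : n ≠ 0) (z : Fin 2 ⊕ Fin 2 → ℝ) :
    extremesEvent X n z = {ω | ∀ p : Fin n × Fin 2, X n p.1 p.2 ω ∈
      Set.Ioc (-normLevel n (z (.inr p.2))) (normLevel n (z (.inl p.2)))} := by
  have : Nonempty (Fin n) := ⟨⟨0, Nat.pos_of_ne_zero hn⟩⟩
  ext ω
  have below (i : Fin 2) : BddBelow (Set.range fun k : Fin n => X n k i ω) :=
    (Set.finite_range _).bddBelow
  have above (i : Fin 2) : BddAbove (Set.range fun k : Fin n => X n k i ω) :=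
    (Set.finite_range _).bddAbove
  constructor
  · rintro h ⟨k, i⟩
    obtain ⟨lower, -, upper⟩ := h i
    exact ⟨lower.trans_le (ciInf_le (below i) k), (le_ciSup (above i) k).trans upper⟩
  · intro h i
    obtain ⟨k, hk⟩ := exists_eq_ciInf_of_finite (f := fun k : Fin n => X n k i ω)
    exact ⟨(h (k, i)).1.trans_eq hk, (ciInf_le (below i) k).trans (le_ciSup (above i) k),
      ciSup_le fun k => (h (k, i)).2⟩

lemma extremesEvent_inf {n : ℕ} (hn : 2 ≤ n) (z w : Fin 2 ⊕ Fin 2 → ℝ) :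
    extremesEvent X n (z ⊓ w) = extremesEvent X n z ∩ extremesEvent X n w := by
  have mono := (normLevel_strictMono hn).monotone
  ext ω
  simp only [extremesEvent_eq_box (show n ≠ 0 by omega), Set.mem_inter_iff, Set.mem_ofPred_eq,
    ← forall_and, Pi.inf_apply, mono.map_min, Set.mem_Ioc, le_inf_iff, neg_lt, lt_inf_iff]
  exact forall_congr' fun p => by tauto

variable [MeasurableSpace Ω] {P : Measure Ω} {ρ₀ : ℕ → ℝ} {ρ : Fin 2 → Fin 2 → ℕ → ℕ → ℝ}

namespace IsStationaryGaussianArray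

lemma memLp (hX : IsStationaryGaussianArray P X ρ₀ ρ) {n : ℕ} (k : Fin n) (i : Fin 2) :
    MemLp (X n k i) 2 P :=
  (HasGaussianLaw.eval (X := fun (p : Fin n × Fin 2) => X n p.1 p.2) (hX.gaussian n)
    (k, i)).memLp_two

lemma nullMeasurableSet_extremesEvent (hX : IsStationaryGaussianArray P X ρ₀ ρ) {n : ℕ}
    (hn : n ≠ 0) (z : Fin 2 ⊕ Fin 2 → ℝ) : NullMeasurableSet (extremesEvent X n z) P := by
  rw [extremesEvent_eq_box hn, Set.ofPred_forall]
  exact .iInter fun p =>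
    (hX.memLp p.1 p.2).aemeasurable.nullMeasurableSet_preimage measurableSet_Ioc

lemma abs_corr_le_one (hX : IsStationaryGaussianArray P X ρ₀ ρ) {n : ℕ} (hn : n ≠ 0) :
    |ρ₀ n| ≤ 1 := by
  have := (hX.gaussian n).isProbabilityMeasure
  set k : Fin n := ⟨0, Nat.pos_of_ne_zero hn⟩
  have add := variance_add (hX.memLp k 0) (hX.memLp k 1)
  have sub := variance_sub (hX.memLp k 0) (hX.memLp k 1)
  rw [hX.unit_variance, hX.unit_variance, hX.corr_same] at add sub
  rw [abs_le]
  constructor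
  · linarith [variance_nonneg (X n k 0 + X n k 1) P]
  · linarith [variance_nonneg (X n k 0 - X n k 1) P]

lemma covariance_same (hX : IsStationaryGaussianArray P X ρ₀ ρ) {n : ℕ} (k : Fin n)
    (i j : Fin 2) : cov[X n k i, X n k j; P] = if i = j then 1 else ρ₀ n := by
  have diagonal (i : Fin 2) : cov[X n k i, X n k i; P] = 1 := by
    rw [covariance_self (hX.memLp k i).aemeasurable, hX.unit_variance]
  fin_cases i <;> fin_cases j
  · exact diagonal 0
  · exact hX.corr_same n k
  · exact (covariance_comm _ _).trans (hX.corr_same n k)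
  · exact diagonal 1

lemma covariance_sub_covariance_pairCoord (hX : IsStationaryGaussianArray P X ρ₀ ρ) {n : ℕ}
    (hn : n ≠ 0) (p q : Fin n × Fin 2) :
    cov[X n p.1 p.2, X n q.1 q.2; P] - cov[fun ω => pairCoord p.2 (ω p.1),
      fun ω => pairCoord q.2 (ω q.1); iidPairLaw (ρ₀ n) n] = lagCorr ρ p q := by
  rw [lagCorr]
  split_ifs with same
  · rw [← same, hX.covariance_same, covariance_pairCoord_same (hX.abs_corr_le_one hn), sub_self]
  · rw [hX.corr_lag n _ _ _ _ same, covariance_pairCoord_of_ne _ same, sub_zero, lag]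

lemma max_abs_covariance_of_ne (hX : IsStationaryGaussianArray P X ρ₀ ρ) {n : ℕ}
    {p q : Fin n × Fin 2} (hpq : lagCorr ρ p q ≠ 0) :
    max |cov[X n p.1 p.2, X n q.1 q.2; P]| |cov[fun ω => pairCoord p.2 (ω p.1),
      fun ω => pairCoord q.2 (ω q.1); iidPairLaw (ρ₀ n) n]| = |lagCorr ρ p q| := by
  rw [lagCorr, ite_ne_left_iff] at hpq
  rw [lagCorr, if_neg hpq.1, hX.corr_lag n _ _ _ _ hpq.1, covariance_pairCoord_of_ne _ hpq.1,
    abs_zero, max_eq_left (abs_nonneg _), lag]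

lemma isDistributionLike_real_extremesEvent (hX : IsStationaryGaussianArray P X ρ₀ ρ)
    {n : ℕ} (hn : 2 ≤ n) :
    IsDistributionLike fun z => P.real (extremesEvent X n z) where
  nonneg _ := measureReal_nonneg
  monotone z w hzw := by
    have := (hX.gaussian n).isProbabilityMeasure
    refine measureReal_mono ?_
    rw [← inf_eq_left.2 hzw, extremesEvent_inf hn]
    exact Set.inter_subset_right
  sub_inf_le z w := by
    have := (hX.gaussian n).isProbabilityMeasure
    have measurable := hX.nullMeasurableSet_extremesEvent (show n ≠ 0 by omega) w
    rw [extremesEvent_inf hn, ← probReal_compl_eq_one_sub₀ measurable,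
      ← measureReal_inter_add_sdiff₀ (s := extremesEvent X n z) measurable, add_sub_cancel_left]
    exact measureReal_mono (Set.sdiff_subset_compl _ _)

/-- The normal comparison of a row with independent pairs that have the same law as its pairs. -/
lemma abs_real_extremesEvent_sub_pow_le (hX : IsStationaryGaussianArray P X ρ₀ ρ) {n : ℕ}
    (hn : n ≠ 0) {σ w : ℝ} (hρ : ∀ k i j, 1 ≤ k → k < n → |ρ i j k n| ≤ σ) (hσ : σ < 1)
    (hw : 0 ≤ w) {z : Fin 2 ⊕ Fin 2 → ℝ} (hz : ∀ i, w ≤ normLevel n (z i)) :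
    |P.real (extremesEvent X n z) - (bivLaw (ρ₀ n)).real
      (Set.Ioc (-normLevel n (z (.inr 0))) (normLevel n (z (.inl 0))) ×ˢ
        Set.Ioc (-normLevel n (z (.inr 1))) (normLevel n (z (.inl 1)))) ^ n| ≤
      (Real.pi * √(1 - σ ^ 2))⁻¹ * ∑ p : Fin n × Fin 2, ∑ q : Fin n × Fin 2,
        |lagCorr ρ p q| * Real.exp (-w ^ 2 / (1 + |lagCorr ρ p q|)) := by
  rw [extremesEvent_eq_box hn, ← iidPairLaw_real_pairCoord (ρ₀ n) n fun i =>
    Set.Ioc (-normLevel n (z (.inr i))) (normLevel n (z (.inl i)))]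
  refine (normal_comparison (σ := σ) (w := w) (X := fun p : Fin n × Fin 2 => X n p.1 p.2)
    (Y := fun (p : Fin n × Fin 2) (ω : Fin n → ℝ × ℝ) => pairCoord p.2 (ω p.1))
    (a := fun p => -normLevel n (z (.inr p.2))) (b := fun p => normLevel n (z (.inl p.2)))
    (hX.gaussian n) (hasGaussianLaw_pairCoord (ρ₀ n) n) (fun p => hX.mean_zero n p.1 p.2)
    (fun p => integral_pairCoord (ρ₀ n) p.1 p.2) (fun p => hX.unit_variance n p.1 p.2)
    (fun p => variance_pairCoord (hX.abs_corr_le_one hn) p.1 p.2) hσ (fun p q h => ?_) hw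
    (fun p => ?_) (fun p => (hz _).trans (le_abs_self _)) fun p => ?_).trans_eq ?_
  · rw [← sub_ne_zero, hX.covariance_sub_covariance_pairCoord hn] at h
    rw [hX.max_abs_covariance_of_ne h]
    rw [lagCorr, ite_ne_left_iff] at h
    rw [lagCorr, if_neg h.1]
    exact hρ _ _ _ (lag_pos h.1) (lag_lt _ _)
  · rw [abs_neg]
    exact (hz _).trans (le_abs_self _)
  · linarith [hz (.inl p.2), hz (.inr p.2)]
  · congr 1
    refine Finset.sum_congr rfl fun p _ => Finset.sum_congr rfl fun q _ => ?_
    rw [hX.covariance_sub_covariance_pairCoord hn]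
    by_cases hpq : lagCorr ρ p q = 0
    · rw [hpq, abs_zero, zero_mul, zero_mul]
    · rw [hX.max_abs_covariance_of_ne hpq]

lemma tendsto_real_extremesEvent (hX : IsStationaryGaussianArray P X ρ₀ ρ)
    (hA : WeakDependence ρ) {lam : ℝ≥0∞} (hlam : HuslerReissCondition ρ₀ lam)
    (hneg : lam = ⊤ → Tendsto (fun n : ℕ => (1 + ρ₀ n) * Real.log n) atTop atTop)
    (z : Fin 2 ⊕ Fin 2 → ℝ) :
    Tendsto (fun n => P.real (extremesEvent X n z)) atTop (𝓝 (limitCDF lam z)) := by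
  obtain ⟨σ, α, hlub, hσ, -, hα, late⟩ := hA
  have corr_le (n : ℕ) (hn : 2 ≤ n) (k i j) (hk : 1 ≤ k) (hkn : k < n) : |ρ i j k n| ≤ σ :=
    hlub.1 ⟨n, k, i, j, hn, hk, hkn, rfl⟩
  have σ_nonneg : 0 ≤ σ := (abs_nonneg _).trans (corr_le 2 le_rfl 1 0 0 le_rfl one_lt_two)
  have abs_le_one : ∀ᶠ n in atTop, |ρ₀ n| ≤ 1 :=
    (eventually_ne_atTop 0).mono fun n => hX.abs_corr_le_one
  have independent := hlam.tendsto_bivLaw_prod_Ioc_pow abs_le_one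
    (hlam.tendsto_one_add_atTop abs_le_one hneg) (z (.inl 0)) (z (.inl 1)) (z (.inr 0)) (z (.inr 1))
  obtain ⟨z₀, hz₀⟩ := (Set.finite_range z).bddBelow
  have bound := (((tendsto_early_terms σ_nonneg hα z₀).const_mul 8).add
    ((tendsto_late_terms (fun n => NNReal.coe_nonneg _) late z₀).const_mul 4)).const_mul
      (Real.pi * √(1 - σ ^ 2))⁻¹
  rw [mul_zero, mul_zero, add_zero, mul_zero] at bound
  refine (tendsto_iff_of_dist (squeeze_zero' (Eventually.of_forall fun n => dist_nonneg)
    ?_ bound)).2 independent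
  filter_upwards [eventually_ge_atTop 2, eventually_neg_normLevel_lt z₀ z₀] with n hn level_pos
  have mono := (normLevel_strictMono hn).monotone
  exact (hX.abs_real_extremesEvent_sub_pow_le (by omega) (corr_le n hn) hσ (by linarith)
    fun i => mono (hz₀ ⟨i, rfl⟩)).trans (mul_le_mul_of_nonneg_left
      (sum_abs_lagCorr_mul_exp_le hσ.le _ (corr_le n hn)) (by positivity))

end IsStationaryGaussianArray

end Array

theorem theorem2p1 {Ω : Type*} [MeasurableSpace Ω] (P : Measure Ω) [IsProbabilityMeasure P]
    (X : (n : ℕ) → Fin n → Fin 2 → Ω → ℝ) (ρ₀ : ℕ → ℝ) (ρ : Fin 2 → Fin 2 → ℕ → ℕ → ℝ)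
    (hX : IsStationaryGaussianArray P X ρ₀ ρ) (hA : WeakDependence ρ)
    (lam : ℝ≥0∞) (hlam : HuslerReissCondition ρ₀ lam)
    (hneg : lam = ⊤ → Tendsto (fun n : ℕ => (1 + ρ₀ n) * Real.log n) atTop atTop) :
    Tendsto
      (fun n : ℕ => ⨆ z : (Fin 2 → ℝ) × (Fin 2 → ℝ),
        |P.real {ω | ∀ i : Fin 2, -normLevel n (z.2 i) < rowMin X n i ω ∧
              rowMin X n i ω ≤ rowMax X n i ω ∧ rowMax X n i ω ≤ normLevel n (z.1 i)}
          - huslerReissCDF lam (z.1 0) (z.1 1) * huslerReissCDF lam (z.2 0) (z.2 1)|)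
      atTop (𝓝 0) := by
  have uniform : TendstoUniformly (fun n z => P.real (extremesEvent X n z)) (limitCDF lam) atTop :=
    tendstoUniformly_of_isDistributionLike
      ((eventually_ge_atTop 2).mono fun n hn => hX.isDistributionLike_real_extremesEvent hn)
      (continuous_limitCDF lam) (hX.tendsto_real_extremesEvent hA hlam hneg)
      (tendsto_limitCDF_diag_atTop lam) tendsto_gumbelCDF_atBot (limitCDF_le_gumbelCDF lam)
  exact (tendsto_iSup_abs_sub_of_tendstoUniformly uniform).congr fun n =>
    (Equiv.sumArrowEquivProdArrow (Fin 2) (Fin 2) ℝ).iSup_congr fun z => rfl
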